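/- **Setting.** A system processes tasks of $N$ classes over frames $k=0,1,2,\dots$. On frame $k$ a class $c[k]\in\{1,\dots,N\}$, a mode $m[k]$ from a finite set $\mathcal M$ and an idle time $I[k]\in[0,I_{max}]$ (with $I_{max}>0$) are chosen; the frame has active time $D[k]$ and energy $e[k]$. Given $(c[k],m[k])$, the pair $(D[k],e[k])$ is conditionally independent of the past, with a given conditional distribution whose means $\hat D(c,m)$, $\hat e(c,m)$ do not depend on $k$, with $D[k]\ge D_{min}>0$ and with conditional second moments of $D[k]$ and $e[k]$ at most $\sigma^2<\infty$. Let $1_n[k]=1$ if $c[k]=n$ and $0$ otherwise, and let $\lambda_1,\dots,\lambda_N$ be given rates. A policy is any (possibly randomized, history dependent) way of making the decisions. The power-minimization problem is to minimize $\bar e/(\bar D+\bar I)$ over all policies for which the frame averages $\frac1K\sum_{k<K}e[k]$, $\frac1K\sum_{k<K}D[k]$, $\frac1K\sum_{k<K}I[k]$, $\frac1K\sum_{k<K}1_n[k]$ converge with probability 1 to constants $\bar e,\bar D,\bar I,\bar 1_n$ satisfying $\bar 1_n/(\bar D+\bar I)\ge\lambda_n$ for all $n$. Let $power^{opt}$ be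 its optimal value (the infimum). The virtual queues are $Q_n[0]=0$ and $$Q_n[k+1]=\max\{Q_n[k]+\lambda_n(D[k]+I[k])-1_n[k],\,0\},$$ with $\mathbf Q[k]=(Q_1[k],\dots,Q_N[k])$ and $\|\mathbf Q[k]\|=\sqrt{\sum_n Q_n[k]^2}$. For a parameter $V\ge 0$, the drift-plus-penalty-ratio task scheduling algorithm chooses on every frame, given $\mathbf Q[k]$, a triple $(c[k],m[k],I[k])$ that minimizes $$\frac{V\hat e(c,m)-Q_c[k]}{\hat D(c,m)+I}$$ over all $c\in\{1,\dots,N\}$, $m\in\mathcal M$, $0\le I\le I_{max}$, breaking ties arbitrarily. Put $\bar e[K]=\frac1K\sum_{k<K}\mathbb E\,e[k]$, and similarly $\bar D[K]$, $\bar I[K]$, $\bar 1_n[K]$. **Theorem.** Suppose the power-minimization problem is feasible. Then there are finite constants $B$ and $\beta$ such that, under every policy, for all $k$, $$B\ge\tfrac12\sum_{n=1}^N\mathbb E\big[(\lambda_n(D[k]+I[k])-1_n[k])^2\,\big|\,\mathbf Q[k]\big]\ \text{ almost surely},\qquad \beta\ge\mathbb E\big[power^{opt}(D[k]+I[k])-e[k]\big].$$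 Under the task scheduling algorithm, for any constants $B$, $\beta$ satisfying these inequalities for all $k$ (under the algorithm), the expectations below are those of integrable random variables, and: (a) if $V>0$, then for all $K\in\{1,2,3,\dots\}$, $$\frac{\bar e[K]}{\bar D[K]+\bar I[K]}\le power^{opt}+\frac{B}{V(\bar D[K]+\bar I[K])}$$ (for this part only $B$ is needed); (b) for all $K\in\{1,2,3,\dots\}$, $$\frac{\mathbb E\|\mathbf Q[K]\|}{K}\le\sqrt{\frac{2(B+V\beta)}{K}},$$ and for every $n$: the queue is mean rate stable, $\lim_{K\to\infty}\mathbb E[Q_n[K]]/K=0$, so that $\limsup_{K\to\infty}\big[\lambda_n(\bar D[K]+\bar I[K])-\bar 1_n[K]\big]\le 0$; and the queue is rate stable, $\lim_{K\to\infty}Q_n[K]/K=0$ with probability 1, so that $\limsup_{K\to\infty}\frac1K\sum_{k<K}\big[\lambda_n(D[k]+I[k])-1_n[k]\big]\le0$ with probability 1. -/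

import Mathlib

open MeasureTheory Filter Topology

universe u v

noncomputable section

namespace TaskScheduling

/-- A processing system with `N` task classes and set of processing modes `M`.
`law k (c, m)` is the conditional joint distribution of the pair (active time `D[k]`, energy `e[k]`)
on frame `k` when a task of class `c` is processed in mode `m`. It may be arbitrary, and may change
from frame to frame, subject to: its means `Dhat (c, m)` and `ehat (c, m)` are the same on every
frame, active times are at least `Dmin > 0`, and second moments are at most `sigma ^ 2`. -/
structure System (N : ℕ) (M : Type*) where
  law : ℕ → Fin N × M → Measure (ℝ × ℝ)
  Dhat : Fin N × M → ℝ
  ehat : Fin N × M → ℝ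
  Dmin : ℝ
  Imax : ℝ
  sigma : ℝ
  isProbabilityMeasure_law : ∀ k a, IsProbabilityMeasure (law k a)
  Dmin_pos : 0 < Dmin
  Imax_pos : 0 < Imax
  Dmin_le : ∀ k a, ∀ᵐ x ∂(law k a), Dmin ≤ x.1
  memLp_D : ∀ k a, MemLp (fun x : ℝ × ℝ => x.1) 2 (law k a)
  memLp_e : ∀ k a, MemLp (fun x : ℝ × ℝ => x.2) 2 (law k a)
  sq_D_le : ∀ k a, ∫ x, x.1 ^ 2 ∂(law k a) ≤ sigma ^ 2
  sq_e_le : ∀ k a, ∫ x, x.2 ^ 2 ∂(law k a) ≤ sigma ^ 2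
  mean_D : ∀ k a, ∫ x, x.1 ∂(law k a) = Dhat a
  mean_e : ∀ k a, ∫ x, x.2 ∂(law k a) = ehat a

/-- The random trajectory of a system: on frame `k`, the class `c k`, the mode `m k`, the idle time
`I k`, the active time `D k` and the energy `e k`. -/
structure Trajectory (N : ℕ) (M : Type*) (Ω : Type*) where
  c : ℕ → Ω → Fin N
  m : ℕ → Ω → M
  I : ℕ → Ω → ℝ
  D : ℕ → Ω → ℝ
  e : ℕ → Ω → ℝ

namespace Trajectory

variable {N : ℕ} {M Ω : Type*}

/-- The indicator `1_n[k]` of the event that class `n` is processed on frame `k`. -/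
def ind (X : Trajectory N M Ω) (n : Fin N) (k : ℕ) (ω : Ω) : ℝ :=
  if X.c k ω = n then 1 else 0

/-- The σ-algebra generated by everything that happened on the frames before frame `k`. -/
@[reducible] def past (X : Trajectory N M Ω) (k : ℕ) : MeasurableSpace Ω :=
  ⨆ j : Fin k,
    (⊤ : MeasurableSpace (Fin N)).comap (X.c j) ⊔ (⊤ : MeasurableSpace M).comap (X.m j) ⊔
    (borel ℝ).comap (X.I j) ⊔ (borel ℝ).comap (X.D j) ⊔ (borel ℝ).comap (X.e j)

/-- The σ-algebra generated by the past of frame `k` and the decision `(c[k], m[k])`. -/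
@[reducible] def pastAction (X : Trajectory N M Ω) (k : ℕ) : MeasurableSpace Ω :=
  X.past k ⊔ (⊤ : MeasurableSpace (Fin N)).comap (X.c k) ⊔ (⊤ : MeasurableSpace M).comap (X.m k)

/-- The virtual queues, started at zero:
`Q_n[k+1] = max (Q_n[k] + λ_n (D[k] + I[k]) - 1_n[k]) 0`. -/
def queue (X : Trajectory N M Ω) (lam : Fin N → ℝ) : ℕ → Fin N → Ω → ℝ
  | 0, _, _ => 0
  | k + 1, n, ω =>
      max (X.queue lam k n ω + lam n * (X.D k ω + X.I k ω) - X.ind n k ω) 0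

/-- The Euclidean norm of the queue vector. -/
def queueNorm (X : Trajectory N M Ω) (lam : Fin N → ℝ) (k : ℕ) (ω : Ω) : ℝ :=
  Real.sqrt (∑ n, X.queue lam k n ω ^ 2)

/-- The σ-algebra generated by the queue vector `Q[k]`. -/
@[reducible] def queueSigma (X : Trajectory N M Ω) (lam : Fin N → ℝ) (k : ℕ) : MeasurableSpace Ω :=
  MeasurableSpace.comap (fun ω => fun n : Fin N => X.queue lam k n ω) MeasurableSpace.pi

end Trajectory

/-- The average over the first `K` frames along an outcome, `(1/K) ∑_{k<K} f[k]`. -/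
def frameAvg {Ω : Type*} (f : ℕ → Ω → ℝ) (K : ℕ) (ω : Ω) : ℝ :=
  (1 / (K : ℝ)) * ∑ k ∈ Finset.range K, f k ω

/-- The frame average expectation `(1/K) ∑_{k<K} E[f[k]]`. -/
def expAvg {Ω : Type*} [MeasurableSpace Ω] (P : Measure Ω) (f : ℕ → Ω → ℝ) (K : ℕ) : ℝ :=
  (1 / (K : ℝ)) * ∑ k ∈ Finset.range K, ∫ ω, f k ω ∂P

namespace System

variable {N : ℕ} {M : Type*}

/-- `X` is the trajectory of the system `S` under some (possibly randomized and history dependent)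
control policy: idle times lie in `[0, Imax]` and, on each frame `k`, the pair `(D[k], e[k])` is
conditionally independent of the past given `(c[k], m[k])`, with conditional distribution
`law k (c[k], m[k])`. The idle time may be chosen at the end of the active period. -/
structure IsPolicy (S : System N M) {Ω : Type*} [MeasurableSpace Ω] (P : Measure Ω)
    (X : Trajectory N M Ω) : Prop where
  measurable_c : ∀ k, Measurable[_, ⊤] (X.c k)
  measurable_m : ∀ k, Measurable[_, ⊤] (X.m k)
  measurable_I : ∀ k, Measurable (X.I k)
  measurable_D : ∀ k, Measurable (X.D k)
  measurable_e : ∀ k, Measurable (X.e k)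
  idle_mem : ∀ k ω, X.I k ω ∈ Set.Icc 0 S.Imax
  cond_law : ∀ k (s : Set (ℝ × ℝ)), MeasurableSet s →
    P[fun ω => s.indicator (fun _ => (1 : ℝ)) (X.D k ω, X.e k ω) | X.pastAction k]
      =ᵐ[P] fun ω => (S.law k (X.c k ω, X.m k ω)).real s

/-- `p` is the time average power of some policy that is feasible for the problem of minimizing
average power subject to the processing rate constraints: the frame averages of `e`, `D`, `I` and
`1_n` converge almost surely to constants with `1_n / (D + I) ≥ λ_n` for all `n`, and
`p = e / (D + I)`. (The law of a trajectory lives on a space of sequences, so probability spaces in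
the lowest universe are enough to realize every policy.) -/
def IsFeasiblePower (S : System N M) (lam : Fin N → ℝ) (p : ℝ) : Prop :=
  ∃ (Ω : Type) (_ : MeasurableSpace Ω) (P : Measure Ω) (_ : IsProbabilityMeasure P)
    (X : Trajectory N M Ω) (ebar Dbar Ibar : ℝ) (onebar : Fin N → ℝ),
    S.IsPolicy P X ∧
    (∀ᵐ ω ∂P, Tendsto (fun K => frameAvg X.e K ω) atTop (𝓝 ebar)) ∧
    (∀ᵐ ω ∂P, Tendsto (fun K => frameAvg X.D K ω) atTop (𝓝 Dbar)) ∧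
    (∀ᵐ ω ∂P, Tendsto (fun K => frameAvg X.I K ω) atTop (𝓝 Ibar)) ∧
    (∀ n, ∀ᵐ ω ∂P, Tendsto (fun K => frameAvg (X.ind n) K ω) atTop (𝓝 (onebar n))) ∧
    (∀ n, lam n ≤ onebar n / (Dbar + Ibar)) ∧
    p = ebar / (Dbar + Ibar)

/-- The power minimization problem is feasible. -/
def Feasible (S : System N M) (lam : Fin N → ℝ) : Prop :=
  ∃ p, S.IsFeasiblePower lam p

/-- The optimal value of the power minimization problem. (Feasible powers are bounded below, because
second moments of the energy are bounded and active times are at least `Dmin`.) -/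
def powerOpt (S : System N M) (lam : Fin N → ℝ) : ℝ :=
  sInf {p | S.IsFeasiblePower lam p}

/-- `X` is the trajectory of `S` under the drift-plus-penalty ratio task scheduling algorithm with
parameter `V`: on every frame, given the queue vector `Q[k]`, the decision `(c[k], m[k], I[k])`
minimizes `(V ehat(c, m) - Q_c[k]) / (Dhat(c, m) + I)` over all classes `c`, modes `m` and
`0 ≤ I ≤ Imax`, with ties broken arbitrarily. -/
structure IsAlgorithm (S : System N M) (lam : Fin N → ℝ) (V : ℝ) {Ω : Type*} [MeasurableSpace Ω]
    (P : Measure Ω) (X : Trajectory N M Ω) : Prop extends S.IsPolicy P X where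
  minimizes : ∀ k ω (c : Fin N) (m : M) (I : ℝ), I ∈ Set.Icc 0 S.Imax →
    (V * S.ehat (X.c k ω, X.m k ω) - X.queue lam k (X.c k ω) ω) /
        (S.Dhat (X.c k ω, X.m k ω) + X.I k ω)
      ≤ (V * S.ehat (c, m) - X.queue lam k c ω) / (S.Dhat (c, m) + I)

/-- `B ≥ (1/2) ∑_n E[(λ_n (D[k] + I[k]) - 1_n[k])² | Q[k]]` almost surely on every frame `k`. -/
def IsDriftBound {Ω : Type*} [MeasurableSpace Ω] (P : Measure Ω) (lam : Fin N → ℝ)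
    (X : Trajectory N M Ω) (B : ℝ) : Prop :=
  ∀ k, ∀ᵐ ω ∂P,
    (1 / 2) * ∑ n,
      (P[fun ω' => (lam n * (X.D k ω' + X.I k ω') - X.ind n k ω') ^ 2 | X.queueSigma lam k]) ω ≤ B

/-- `β ≥ E[power^opt (D[k] + I[k]) - e[k]]` on every frame `k`. -/
def IsPenaltyBound (S : System N M) {Ω : Type*} [MeasurableSpace Ω] (P : Measure Ω)
    (lam : Fin N → ℝ) (X : Trajectory N M Ω) (β : ℝ) : Prop :=
  ∀ k, ∫ ω, (S.powerOpt lam * (X.D k ω + X.I k ω) - X.e k ω) ∂P ≤ β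

end System

end TaskScheduling

end

noncomputable section

/-! The engine is a comparison of ratios. Fix queue weights `q` and let `r` be any lower bound for
the one-frame ratios `(V ê - q_c) / (D̂ + I)`. Clearing denominators and averaging over the frames
of a feasible policy gives `r (D̄ + Ī) ≤ V ē - ∑ q_n 1̄_n`, and the rate constraints turn this into
`r + ∑ q_n λ_n ≤ V p` for its power `p` (`IsFeasiblePower.ratio_add_le`). This works along a single
outcome, once a strong law for martingale differences has replaced `D[k]`, `e[k]` by their
conditional means. No optimal or stationary policy has to exist: the infimum over `p` is taken last.

The algorithm attains the least ratio for `q = Q[k]`. Multiplying by `D̂ + I` therefore bounds drift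
plus penalty, pathwise, by `V power^opt (D̂ + I)` (`IsAlgorithm.drift_plus_penalty_le`). Since
`Q[k]` is determined by the past, `D̂` and `ê` become `D` and `e` under expectation, and telescoping
the Lyapunov function `‖Q‖² / 2` gives `sum_integral_queue_sq_le`. Discarding its left side yields
(a); bounding its right side by `β` gives `E‖Q[K]‖² ≤ 2 (B + Vβ) K`, hence (b) by Jensen. Almost
sure stability follows from `E Q_n[K]² = O(K)` and increments with bounded second moments, by
Borel–Cantelli-type summation along the squares. -/

namespace TaskScheduling

/-! ### Almost sure convergence from second moment bounds -/

/-- Nonnegative random variables with summable expectations tend to zero almost surely. -/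
theorem ae_tendsto_zero_of_summable_integral {Ω : Type*} [MeasurableSpace Ω] {P : Measure Ω}
    {G : ℕ → Ω → ℝ} (hG : ∀ j, Integrable (G j) P) (hnn : ∀ j ω, 0 ≤ G j ω)
    {b : ℕ → ℝ} (hb : Summable b) (hle : ∀ j, ∫ ω, G j ω ∂P ≤ b j) :
    ∀ᵐ ω ∂P, Tendsto (fun j => G j ω) atTop (𝓝 0) := by
  have hmeas : ∀ j, AEMeasurable (fun ω => ENNReal.ofReal (G j ω)) P :=
    fun j => (hG j).aestronglyMeasurable.aemeasurable.ennreal_ofReal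
  have hfin : ∫⁻ ω, ∑' j, ENNReal.ofReal (G j ω) ∂P ≠ ⊤ := by
    rw [lintegral_tsum hmeas]
    have hb0 : ∀ j, 0 ≤ b j := fun j => (integral_nonneg (hnn j)).trans (hle j)
    refine ne_top_of_le_ne_top ?_ (ENNReal.tsum_le_tsum (g := fun j => ENNReal.ofReal (b j)) ?_)
    · rw [← ENNReal.ofReal_tsum_of_nonneg hb0 hb]
      exact ENNReal.ofReal_ne_top
    · intro j
      rw [← ofReal_integral_eq_lintegral_ofReal (hG j) (ae_of_all _ (hnn j))]
      exact ENNReal.ofReal_le_ofReal (hle j)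
  filter_upwards [ae_lt_top' (AEMeasurable.tsum hmeas) hfin] with ω hω
  have h := ENNReal.tendsto_atTop_zero_of_tsum_ne_top hω.ne
  have h2 := (ENNReal.tendsto_toReal ENNReal.zero_ne_top).comp h
  simpa [Function.comp_def, ENNReal.toReal_ofReal (hnn _ ω)] using h2

/-- Controls a sequence between consecutive squares by its value at `j ^ 2`: telescope, apply
Cauchy–Schwarz to the increments, then `(a + b)² ≤ 2 (a² + b²)`. -/
theorem sq_le_of_increments (s : ℕ → ℝ) {j k : ℕ} (h1 : j ^ 2 ≤ k) (h2 : k ≤ j ^ 2 + 2 * j) :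
    s k ^ 2 ≤ 2 * (s (j ^ 2) ^ 2 +
      (2 * j + 1) * ∑ i ∈ Finset.range (2 * j + 1),
        (s (j ^ 2 + i + 1) - s (j ^ 2 + i)) ^ 2) := by
  obtain ⟨l, rfl⟩ := Nat.exists_eq_add_of_le h1
  have hl : l ≤ 2 * j + 1 := by omega
  have htel : ∑ i ∈ Finset.range l, (s (j ^ 2 + i + 1) - s (j ^ 2 + i))
      = s (j ^ 2 + l) - s (j ^ 2) := by
    exact Finset.sum_range_sub (fun i => s (j ^ 2 + i)) l
  have hcs := sq_sum_le_card_mul_sum_sq (s := Finset.range l)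
    (f := fun i => s (j ^ 2 + i + 1) - s (j ^ 2 + i))
  rw [htel, Finset.card_range] at hcs
  have hmono : ∑ i ∈ Finset.range l, (s (j ^ 2 + i + 1) - s (j ^ 2 + i)) ^ 2
      ≤ ∑ i ∈ Finset.range (2 * j + 1), (s (j ^ 2 + i + 1) - s (j ^ 2 + i)) ^ 2 :=
    Finset.sum_le_sum_of_subset_of_nonneg (by simpa using hl) fun _ _ _ => sq_nonneg _
  have hl' : (l : ℝ) ≤ 2 * j + 1 := by exact_mod_cast hl
  have hprod := mul_le_mul hl' hmono (Finset.sum_nonneg fun _ _ => sq_nonneg _) (by positivity)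
  nlinarith [sq_nonneg (s (j ^ 2 + l) - 2 * s (j ^ 2))]

/-- A process with `E[S_k²] = O(k)` and square-integrably bounded increments satisfies
`S_k / k → 0` almost surely. -/
theorem ae_tendsto_div_of_integral_sq_le {Ω : Type*} [MeasurableSpace Ω] {P : Measure Ω}
    {S : ℕ → Ω → ℝ} {C : ℝ} (hS : ∀ k, MemLp (S k) 2 P)
    (hsq : ∀ k : ℕ, ∫ ω, S k ω ^ 2 ∂P ≤ C * k)
    (hinc : ∀ k, ∫ ω, (S (k + 1) ω - S k ω) ^ 2 ∂P ≤ C) :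
    ∀ᵐ ω ∂P, Tendsto (fun k : ℕ => S k ω / k) atTop (𝓝 0) := by
  have hC : 0 ≤ C := (integral_nonneg fun ω => sq_nonneg _).trans (hinc 0)
  have hincI : ∀ k, Integrable (fun ω => (S (k + 1) ω - S k ω) ^ 2) P :=
    fun k => ((hS (k + 1)).sub (hS k)).integrable_sq
  have hI : ∀ k, Integrable (fun ω => S k ω ^ 2) P := fun k => (hS k).integrable_sq
  -- `2 * G j` dominates `(S k / k) ^ 2` for all `k` in the block from `j ^ 2` to `j ^ 2 + 2 * j`,
  -- so convergence of `G` suffices.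
  set G : ℕ → Ω → ℝ := fun j ω => (S (j ^ 2) ω ^ 2 +
      (2 * j + 1) * ∑ i ∈ Finset.range (2 * j + 1),
        (S (j ^ 2 + i + 1) ω - S (j ^ 2 + i) ω) ^ 2) / (j : ℝ) ^ 4 with hGdef
  have hsumI : ∀ j : ℕ, Integrable (fun ω => (2 * (j : ℝ) + 1) * ∑ i ∈ Finset.range (2 * j + 1),
        (S (j ^ 2 + i + 1) ω - S (j ^ 2 + i) ω) ^ 2) P :=
    fun j => (integrable_finsetSum _ fun i _ => hincI _).const_mul _
  have hG : ∀ j, Integrable (G j) P := fun j => ((hI _).add (hsumI j)).div_const _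
  have hnn : ∀ j ω, 0 ≤ G j ω := fun j ω => by
    have : 0 ≤ ∑ i ∈ Finset.range (2 * j + 1),
        (S (j ^ 2 + i + 1) ω - S (j ^ 2 + i) ω) ^ 2 := Finset.sum_nonneg fun _ _ => sq_nonneg _
    simp only [hGdef]
    positivity
  -- The constant: `j² + (2j + 1)² ≤ 10 j²` for `j ≥ 1`. At `j = 0` both sides are zero, by division
  -- by zero.
  have hle : ∀ j : ℕ, ∫ ω, G j ω ∂P ≤ 10 * C * (1 / (j : ℝ) ^ 2) := fun j => by
    rcases Nat.eq_zero_or_pos j with rfl | hj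
    · simp [hGdef]
    have hj1 : (1 : ℝ) ≤ j := by exact_mod_cast hj
    simp only [hGdef]
    rw [integral_div, integral_add (hI _) (hsumI j), integral_const_mul,
      integral_finsetSum _ fun i _ => hincI _]
    have h1 := hsq (j ^ 2)
    have h2 : ∑ i ∈ Finset.range (2 * j + 1),
        ∫ ω, (S (j ^ 2 + i + 1) ω - S (j ^ 2 + i) ω) ^ 2 ∂P ≤ (2 * j + 1) * C := by
      refine (Finset.sum_le_card_nsmul _ _ C fun i _ => hinc _).trans_eq ?_
      simp
    have h3 := mul_le_mul_of_nonneg_left h2 (by positivity : (0 : ℝ) ≤ 2 * j + 1)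
    rw [div_le_iff₀ (by positivity)]
    have h4 : 10 * C * (1 / (j : ℝ) ^ 2) * (j : ℝ) ^ 4 = 10 * C * (j : ℝ) ^ 2 := by
      field_simp
    rw [h4]
    push_cast at h1
    nlinarith [mul_nonneg hC (by nlinarith : (0 : ℝ) ≤ (j : ℝ) ^ 2 - j),
      mul_nonneg hC (by nlinarith : (0 : ℝ) ≤ (j : ℝ) ^ 2 - 1)]
  have hb : Summable fun j : ℕ => 10 * C * (1 / (j : ℝ) ^ 2) :=
    (Real.summable_one_div_nat_pow.2 one_lt_two).mul_left _
  filter_upwards [ae_tendsto_zero_of_summable_integral hG hnn hb hle] with ω hω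
  have hsqrt : Tendsto Nat.sqrt atTop atTop :=
    tendsto_atTop_atTop.2 fun b => ⟨b * b, fun a ha => Nat.le_sqrt.2 ha⟩
  have hlim : Tendsto (fun k : ℕ => Real.sqrt (2 * G k.sqrt ω)) atTop (𝓝 0) := by
    have := ((hω.comp hsqrt).const_mul 2).sqrt
    simpa [Function.comp_def] using this
  refine squeeze_zero_norm' ?_ hlim
  filter_upwards [eventually_ge_atTop 1] with k hk
  rw [Real.norm_eq_abs]
  refine Real.abs_le_sqrt ?_
  have h1 := Nat.sqrt_le' k
  have h2 := Nat.sqrt_le_add k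
  have hj : 0 < k.sqrt := Nat.sqrt_pos.2 hk
  have h3 := sq_le_of_increments (fun i => S i ω) h1 (by rw [pow_two]; omega)
  have hj4 : (0 : ℝ) < (k.sqrt : ℝ) ^ 4 := by positivity
  have hk2 : ((k.sqrt : ℝ) ^ 4) ≤ (k : ℝ) ^ 2 := by
    have : ((k.sqrt : ℝ) ^ 2) ≤ k := by exact_mod_cast h1
    calc ((k.sqrt : ℝ) ^ 4) = ((k.sqrt : ℝ) ^ 2) ^ 2 := by ring
      _ ≤ _ := by gcongr
  rw [div_pow, div_le_iff₀ (by positivity)]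
  calc S k ω ^ 2 ≤ _ := h3
    _ = 2 * G k.sqrt ω * (k.sqrt : ℝ) ^ 4 := by
      simp only [hGdef]; field_simp
    _ ≤ 2 * G k.sqrt ω * (k : ℝ) ^ 2 :=
      mul_le_mul_of_nonneg_left hk2 (mul_nonneg zero_le_two (hnn _ _))

/-! ### Measurability with respect to the past, and pathwise queue estimates -/

namespace Trajectory

variable {N : ℕ} {M Ω : Type*} (X : Trajectory N M Ω)

/-- The decision `(c[k], m[k])`. -/
def act (k : ℕ) (ω : Ω) : Fin N × M := (X.c k ω, X.m k ω)

/-- The increment `λ_n (D[k] + I[k]) - 1_n[k]` of the unreflected queue `n`. -/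
def delta (lam : Fin N → ℝ) (k : ℕ) (n : Fin N) (ω : Ω) : ℝ :=
  lam n * (X.D k ω + X.I k ω) - X.ind n k ω

theorem frame_le_past {j k : ℕ} (hjk : j < k) :
    (⊤ : MeasurableSpace (Fin N)).comap (X.c j) ⊔ (⊤ : MeasurableSpace M).comap (X.m j) ⊔
      (borel ℝ).comap (X.I j) ⊔ (borel ℝ).comap (X.D j) ⊔ (borel ℝ).comap (X.e j) ≤ X.past k :=
  le_iSup (fun j : Fin k =>
    (⊤ : MeasurableSpace (Fin N)).comap (X.c j) ⊔ (⊤ : MeasurableSpace M).comap (X.m j) ⊔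
      (borel ℝ).comap (X.I j) ⊔ (borel ℝ).comap (X.D j) ⊔ (borel ℝ).comap (X.e j)) ⟨j, hjk⟩

theorem past_mono {j k : ℕ} (hjk : j ≤ k) : X.past j ≤ X.past k :=
  iSup_le fun i => X.frame_le_past (i.2.trans_le hjk)

theorem past_le_pastAction (k : ℕ) : X.past k ≤ X.pastAction k :=
  le_sup_left.trans le_sup_left

theorem pastAction_le_past_succ (k : ℕ) : X.pastAction k ≤ X.past (k + 1) := by
  have h := X.frame_le_past (Nat.lt_succ_self k)
  refine sup_le (sup_le (X.past_mono (Nat.le_succ k)) (le_trans ?_ h)) (le_trans ?_ h)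
  · exact le_sup_left.trans (le_sup_left.trans (le_sup_left.trans le_sup_left))
  · exact le_sup_right.trans (le_sup_left.trans (le_sup_left.trans le_sup_left))

theorem pastAction_mono : Monotone X.pastAction :=
  monotone_nat_of_le_succ fun k =>
    (X.pastAction_le_past_succ k).trans (X.past_le_pastAction (k + 1))

theorem measurable_D_past {j k : ℕ} (hjk : j < k) : Measurable[X.past k] (X.D j) := by
  rw [measurable_iff_comap_le, BorelSpace.measurable_eq (α := ℝ)]
  exact (le_sup_right.trans le_sup_left).trans (X.frame_le_past hjk)

theorem measurable_e_past {j k : ℕ} (hjk : j < k) : Measurable[X.past k] (X.e j) := by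
  rw [measurable_iff_comap_le, BorelSpace.measurable_eq (α := ℝ)]
  exact le_sup_right.trans (X.frame_le_past hjk)

theorem measurable_I_past {j k : ℕ} (hjk : j < k) : Measurable[X.past k] (X.I j) := by
  rw [measurable_iff_comap_le, BorelSpace.measurable_eq (α := ℝ)]
  exact (le_sup_right.trans (le_sup_left.trans le_sup_left)).trans (X.frame_le_past hjk)

theorem iUnion_inter_act_preimage (k : ℕ) (A : Set Ω) :
    ⋃ a, (A ∩ X.act k ⁻¹' {a}) = A := by
  ext ω; simp

/-- There are finitely many decisions, so every set of them is a finite union of atoms, each an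
intersection of a class event and a mode event. -/
theorem measurableSet_act_preimage [Finite M] (k : ℕ) (t : Set (Fin N × M)) :
    MeasurableSet[X.pastAction k] (X.act k ⁻¹' t) := by
  have h : X.act k ⁻¹' t = ⋃ a ∈ t, (X.c k ⁻¹' {a.1} ∩ X.m k ⁻¹' {a.2}) := by
    ext ω
    simp only [Set.mem_preimage, Set.mem_iUnion, Set.mem_inter_iff, Set.mem_singleton_iff,
      exists_prop, act]
    constructor
    · exact fun h => ⟨_, h, rfl, rfl⟩
    · rintro ⟨a, ha, h1, h2⟩
      rwa [h1, h2]
  rw [h]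
  refine @Set.Finite.measurableSet_biUnion _ _ (X.pastAction k) _ t t.toFinite fun a _ => ?_
  refine @MeasurableSet.inter _ (X.pastAction k) _ _ ?_ ?_
  · exact (le_sup_right.trans le_sup_left :
      (⊤ : MeasurableSpace (Fin N)).comap (X.c k) ≤ X.pastAction k) _ ⟨{a.1}, trivial, rfl⟩
  · exact (le_sup_right :
      (⊤ : MeasurableSpace M).comap (X.m k) ≤ X.pastAction k) _ ⟨{a.2}, trivial, rfl⟩

theorem measurable_comp_act [Finite M] (k : ℕ) {β : Type*} [MeasurableSpace β]
    (g : Fin N × M → β) : Measurable[X.pastAction k] (fun ω => g (X.act k ω)) :=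
  fun s _ => X.measurableSet_act_preimage k (g ⁻¹' s)

theorem measurable_ind [Finite M] (n : Fin N) (k : ℕ) : Measurable[X.pastAction k] (X.ind n k) :=
  X.measurable_comp_act k fun a : Fin N × M => if a.1 = n then (1 : ℝ) else 0

theorem ind_mem (n : Fin N) (k : ℕ) (ω : Ω) : X.ind n k ω = 0 ∨ X.ind n k ω = 1 := by
  unfold ind; split_ifs <;> simp

theorem queue_succ (lam : Fin N → ℝ) (k : ℕ) (n : Fin N) (ω : Ω) :
    X.queue lam (k + 1) n ω = max (X.queue lam k n ω + X.delta lam k n ω) 0 := by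
  rw [queue, delta, add_sub_assoc]

theorem queue_nonneg (lam : Fin N → ℝ) (k : ℕ) (n : Fin N) (ω : Ω) : 0 ≤ X.queue lam k n ω := by
  cases k with
  | zero => exact le_rfl
  | succ k => exact le_max_right _ _

theorem measurable_delta [Finite M] (lam : Fin N → ℝ) (k : ℕ) (n : Fin N) :
    Measurable[X.past (k + 1)] (X.delta lam k n) := by
  have h1 := X.measurable_D_past (Nat.lt_succ_self k)
  have h2 := X.measurable_I_past (Nat.lt_succ_self k)
  have h3 := (X.measurable_ind n k).mono (X.pastAction_le_past_succ k) le_rfl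
  exact (Measurable.const_mul (h1.add h2) (lam n)).sub h3

theorem measurable_queue [Finite M] (lam : Fin N → ℝ) (k : ℕ) (n : Fin N) :
    Measurable[X.past k] (X.queue lam k n) := by
  induction k with
  | zero => exact @measurable_const _ _ _ (X.past 0) (0 : ℝ)
  | succ k ih =>
    have h1 := ih.mono (X.past_mono (Nat.le_succ k)) le_rfl
    have h : X.queue lam (k + 1) n
        = fun ω => max (X.queue lam k n ω + X.delta lam k n ω) 0 := by
      funext ω; exact X.queue_succ lam k n ω
    rw [h]
    exact (h1.add (X.measurable_delta lam k n)).max (@measurable_const _ _ _ (X.past (k + 1)) (0 : ℝ))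

theorem queueSigma_le_past [Finite M] (lam : Fin N → ℝ) (k : ℕ) :
    X.queueSigma lam k ≤ X.past k :=
  measurable_iff_comap_le.1 (@measurable_pi_lambda _ _ _ (X.past k) _ _
    fun n => X.measurable_queue lam k n)

theorem queueSigma_le_pastAction [Finite M] (lam : Fin N → ℝ) (k : ℕ) :
    X.queueSigma lam k ≤ X.pastAction k :=
  (X.queueSigma_le_past lam k).trans (X.past_le_pastAction k)

/-- Reflection at zero is 1-Lipschitz and fixes the nonnegative value `Q_n[k]`. -/
theorem abs_queue_succ_sub_le (lam : Fin N → ℝ) (k : ℕ) (n : Fin N) (ω : Ω) :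
    |X.queue lam (k + 1) n ω - X.queue lam k n ω| ≤ |X.delta lam k n ω| := by
  rw [queue_succ]
  have h := abs_max_sub_max_le_abs (X.queue lam k n ω + X.delta lam k n ω) (X.queue lam k n ω) 0
  rwa [max_eq_left (X.queue_nonneg lam k n ω), add_sub_cancel_left] at h

/-- The Lyapunov drift inequality, from `max(x, 0)² ≤ x²`. -/
theorem queue_succ_sq_le (lam : Fin N → ℝ) (k : ℕ) (n : Fin N) (ω : Ω) :
    X.queue lam (k + 1) n ω ^ 2 ≤ X.queue lam k n ω ^ 2
      + 2 * (X.queue lam k n ω * X.delta lam k n ω) + X.delta lam k n ω ^ 2 := by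
  rw [queue_succ]
  rcases max_cases (X.queue lam k n ω + X.delta lam k n ω) 0 with ⟨h, _⟩ | ⟨h, _⟩ <;> rw [h]
  · exact le_of_eq (by ring)
  · nlinarith [sq_nonneg (X.queue lam k n ω + X.delta lam k n ω)]

/-- Reflection only pushes upward. This converts queue stability into the rate constraints. -/
theorem sum_delta_le_queue (lam : Fin N → ℝ) (K : ℕ) (n : Fin N) (ω : Ω) :
    ∑ k ∈ Finset.range K, X.delta lam k n ω ≤ X.queue lam K n ω := by
  induction K with
  | zero => exact le_rfl
  | succ K ih =>
    rw [Finset.sum_range_succ, queue_succ]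
    exact (by linarith : _ ≤ X.queue lam K n ω + X.delta lam K n ω).trans (le_max_left _ _)

end Trajectory

/-! ### Conditional distribution of the outcome of a frame -/

namespace System

variable {N : ℕ} {M : Type*} (S : System N M)

theorem Dmin_le_Dhat (a : Fin N × M) : S.Dmin ≤ S.Dhat a := by
  have := S.isProbabilityMeasure_law 0 a
  rw [← S.mean_D 0 a]
  have h := integral_mono_ae (integrable_const S.Dmin)
    ((S.memLp_D 0 a).integrable one_le_two) (S.Dmin_le 0 a)
  simpa using h

theorem Dhat_pos (a : Fin N × M) : 0 < S.Dhat a := S.Dmin_pos.trans_le (S.Dmin_le_Dhat a)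

variable {S} {Ω : Type*} [mΩ : MeasurableSpace Ω] {P : Measure Ω} {X : Trajectory N M Ω}

namespace IsPolicy

theorem past_le (h : S.IsPolicy P X) (k : ℕ) : X.past k ≤ mΩ := by
  refine iSup_le fun j => sup_le (sup_le (sup_le (sup_le ?_ ?_) ?_) ?_) ?_
  · exact measurable_iff_comap_le.1 (h.measurable_c j)
  · exact measurable_iff_comap_le.1 (h.measurable_m j)
  · rw [← BorelSpace.measurable_eq (α := ℝ)]; exact measurable_iff_comap_le.1 (h.measurable_I j)
  · rw [← BorelSpace.measurable_eq (α := ℝ)]; exact measurable_iff_comap_le.1 (h.measurable_D j)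
  · rw [← BorelSpace.measurable_eq (α := ℝ)]; exact measurable_iff_comap_le.1 (h.measurable_e j)

theorem pastAction_le (h : S.IsPolicy P X) (k : ℕ) : X.pastAction k ≤ mΩ :=
  (X.pastAction_le_past_succ k).trans (h.past_le (k + 1))

theorem measurable_outcome (h : S.IsPolicy P X) (k : ℕ) :
    Measurable fun ω => (X.D k ω, X.e k ω) :=
  (h.measurable_D k).prodMk (h.measurable_e k)

variable [Finite M]

theorem measurable_comp_act (h : S.IsPolicy P X) (k : ℕ) (g : Fin N × M → ℝ) :
    Measurable fun ω => g (X.act k ω) :=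
  (X.measurable_comp_act k g).mono (h.pastAction_le k) le_rfl

theorem integrable_comp_act [IsFiniteMeasure P] (h : S.IsPolicy P X) (k : ℕ) (g : Fin N × M → ℝ) :
    Integrable (fun ω => g (X.act k ω)) P := by
  obtain ⟨C, hC⟩ := (Set.finite_range fun a => ‖g a‖).bddAbove
  exact Integrable.of_bound (h.measurable_comp_act k g).aestronglyMeasurable C
    (ae_of_all _ fun ω => hC ⟨_, rfl⟩)

/-- On an atom of the decision the conditional law is one fixed measure, so `cond_law`, integrated
over a past event, upgrades from sets to an identity of measures. -/
theorem map_restrict_outcome [IsProbabilityMeasure P] (h : S.IsPolicy P X) (k : ℕ) {A : Set Ω}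
    (hA : MeasurableSet[X.pastAction k] A) (a : Fin N × M) :
    (P.restrict (A ∩ X.act k ⁻¹' {a})).map (fun ω => (X.D k ω, X.e k ω))
      = P (A ∩ X.act k ⁻¹' {a}) • S.law k a := by
  have := S.isProbabilityMeasure_law k a
  set E := A ∩ X.act k ⁻¹' {a} with hE
  have hEm : MeasurableSet[X.pastAction k] E :=
    @MeasurableSet.inter _ (X.pastAction k) _ _ hA (X.measurableSet_act_preimage k {a})
  have hEm' := h.pastAction_le k _ hEm
  ext s hs
  have hpre := h.measurable_outcome k hs
  rw [Measure.map_apply (h.measurable_outcome k) hs, Measure.restrict_apply hpre,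
    Measure.smul_apply, smul_eq_mul]
  have hfun : (fun ω => s.indicator (fun _ => (1 : ℝ)) (X.D k ω, X.e k ω))
      = ((fun ω => (X.D k ω, X.e k ω)) ⁻¹' s).indicator (fun _ => (1 : ℝ)) := rfl
  have hint : Integrable (fun ω => s.indicator (fun _ => (1 : ℝ)) (X.D k ω, X.e k ω)) P := by
    rw [hfun]
    exact (integrable_const _).indicator hpre
  have h1 := setIntegral_condExp (h.pastAction_le k) hint hEm
  rw [setIntegral_congr_ae hEm' ((h.cond_law k s hs).mono fun ω hω _ => hω)] at h1
  have h2 : ∫ ω in E, (S.law k (X.c k ω, X.m k ω)).real s ∂P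
      = ∫ _ω in E, (S.law k a).real s ∂P := by
    refine setIntegral_congr_fun hEm' fun ω hω => ?_
    have : X.act k ω = a := hω.2
    simp only [Trajectory.act] at this
    simp only [this]
  rw [h2, setIntegral_const, hfun, integral_indicator hpre, setIntegral_const,
    smul_eq_mul, smul_eq_mul, mul_one, measureReal_restrict_apply hpre, Measure.real, Measure.real,
    Measure.real, ← ENNReal.toReal_mul] at h1
  exact ((ENNReal.toReal_eq_toReal_iff' (ENNReal.mul_ne_top (measure_ne_top _ _)
    (measure_ne_top _ _)) (measure_ne_top _ _)).1 h1).symm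

theorem integrable_comp_outcome [IsProbabilityMeasure P] (h : S.IsPolicy P X) (k : ℕ)
    {f : ℝ × ℝ → ℝ} (hi : ∀ a, Integrable f (S.law k a)) :
    Integrable (fun ω => f (X.D k ω, X.e k ω)) P := by
  rw [← integrableOn_univ, ← X.iUnion_inter_act_preimage k Set.univ, integrableOn_finite_iUnion]
  intro a
  have hm := h.map_restrict_outcome k (@MeasurableSet.univ _ (X.pastAction k)) a
  have : Integrable f ((P.restrict (Set.univ ∩ X.act k ⁻¹' {a})).map
      (fun ω => (X.D k ω, X.e k ω))) := by
    rw [hm]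
    exact (hi a).smul_measure (measure_ne_top _ _)
  exact this.comp_measurable (h.measurable_outcome k)

/-- Split a past event along the finitely many decisions and integrate `f` against
`map_restrict_outcome` on each piece. -/
theorem condExp_comp_outcome [IsProbabilityMeasure P] (h : S.IsPolicy P X) (k : ℕ)
    {f : ℝ × ℝ → ℝ} (hf : Measurable f) (hi : ∀ a, Integrable f (S.law k a)) :
    P[fun ω => f (X.D k ω, X.e k ω) | X.pastAction k]
      =ᵐ[P] fun ω => ∫ x, f x ∂(S.law k (X.act k ω)) := by
  cases nonempty_fintype M
  have hfI := h.integrable_comp_outcome k hi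
  have hgI := h.integrable_comp_act k fun a => ∫ x, f x ∂(S.law k a)
  refine (ae_eq_condExp_of_forall_setIntegral_eq (h.pastAction_le k) hfI
    (fun A _ _ => hgI.integrableOn) (fun A hA _ => ?_)
    (X.measurable_comp_act k fun a => ∫ x, f x ∂(S.law k a)).aestronglyMeasurable).symm
  have hmeas : ∀ a, MeasurableSet (A ∩ X.act k ⁻¹' {a}) := fun a =>
    (h.pastAction_le k _ hA).inter (h.pastAction_le k _ (X.measurableSet_act_preimage k {a}))
  have hdisj : Pairwise (Function.onFun Disjoint fun a => A ∩ X.act k ⁻¹' {a}) := by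
    intro a b hab
    refine Set.disjoint_left.2 fun ω h1 h2 => hab ?_
    exact (h1.2 : X.act k ω = a).symm.trans h2.2
  rw [← X.iUnion_inter_act_preimage k A, integral_iUnion_fintype hmeas hdisj fun _ => hgI.integrableOn,
    integral_iUnion_fintype hmeas hdisj fun _ => hfI.integrableOn]
  refine Finset.sum_congr rfl fun a _ => ?_
  have hm := h.map_restrict_outcome k hA a
  rw [← integral_map (h.measurable_outcome k).aemeasurable hf.aestronglyMeasurable, hm,
    integral_smul_measure]
  rw [setIntegral_congr_fun (g := fun _ => ∫ x, f x ∂(S.law k a)) (hmeas a), setIntegral_const]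
  · rfl
  · intro ω hω
    have : X.act k ω = a := hω.2
    simp only [this]

end IsPolicy
end System

/-! ### A strong law for martingale differences -/

theorem integral_mul_eq_of_condExp_ae_eq {Ω : Type*} {m mΩ : MeasurableSpace Ω} {P : Measure Ω}
    [IsFiniteMeasure P] (hm : m ≤ mΩ) {Y Z W : Ω → ℝ} (hY : Measurable[m] Y) (hY2 : MemLp Y 2 P)
    (hZ2 : MemLp Z 2 P) (hW : P[Z | m] =ᵐ[P] W) :
    ∫ ω, Y ω * Z ω ∂P = ∫ ω, Y ω * W ω ∂P := by
  have h := condExp_mul_of_stronglyMeasurable_left hY.stronglyMeasurable (hY2.integrable_mul hZ2)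
    (hZ2.integrable one_le_two)
  calc ∫ ω, Y ω * Z ω ∂P = ∫ ω, (P[Y * Z | m]) ω ∂P := (integral_condExp hm).symm
    _ = ∫ ω, Y ω * W ω ∂P := integral_congr_ae (by
      filter_upwards [h, hW] with ω h1 h2
      rw [h1, Pi.mul_apply, h2])

/-- Strong law of large numbers for martingale differences with bounded second moments: the
averages of `Z k` and of its conditional expectations `W k` are asymptotically equal. -/
theorem ae_tendsto_sum_sub_condExp_div {Ω : Type*} {mΩ : MeasurableSpace Ω} {P : Measure Ω}
    [IsFiniteMeasure P] {m : ℕ → MeasurableSpace Ω} (hm : ∀ k, m k ≤ mΩ) (hmono : Monotone m)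
    {Z W : ℕ → Ω → ℝ} (hZ : ∀ k, Measurable[m (k + 1)] (Z k)) (hW : ∀ k, Measurable[m k] (W k))
    (hZ2 : ∀ k, MemLp (Z k) 2 P) (hW2 : ∀ k, MemLp (W k) 2 P)
    (hcond : ∀ k, P[Z k | m k] =ᵐ[P] W k) {C : ℝ} (hC : ∀ k, ∫ ω, Z k ω ^ 2 ∂P ≤ C) :
    ∀ᵐ ω ∂P, Tendsto (fun K : ℕ => (∑ k ∈ Finset.range K, (Z k ω - W k ω)) / K)
      atTop (𝓝 0) := by
  have hsub : ∀ k, MemLp (fun ω => Z k ω - W k ω) 2 P := fun k => (hZ2 k).sub (hW2 k)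
  have hS : ∀ K, MemLp (fun ω => ∑ k ∈ Finset.range K, (Z k ω - W k ω)) 2 P :=
    fun K => memLp_finsetSum _ fun k _ => hsub k
  -- Orthogonality: a martingale difference integrates to zero against any square-integrable
  -- function of its past.
  have horth : ∀ (k : ℕ) (Y : Ω → ℝ), Measurable[m k] Y → MemLp Y 2 P →
      ∫ ω, Y ω * (Z k ω - W k ω) ∂P = 0 := fun k Y hY hY2 => by
    have h1 : Integrable (fun ω => Y ω * Z k ω) P := hY2.integrable_mul (hZ2 k)
    have h2 : Integrable (fun ω => Y ω * W k ω) P := hY2.integrable_mul (hW2 k)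
    simp only [mul_sub]
    rw [integral_sub h1 h2,
      integral_mul_eq_of_condExp_ae_eq (hm k) hY hY2 (hZ2 k) (hcond k), sub_self]
  -- Conditional expectation is an `L²` projection, so the residual has no larger second moment than
  -- `Z k`.
  have hinc : ∀ k, ∫ ω, (Z k ω - W k ω) ^ 2 ∂P ≤ C := fun k => by
    refine le_trans ?_ (hC k)
    have h1 := horth k (W k) (hW k) (hW2 k)
    have h2 : ∫ ω, (Z k ω ^ 2 - 2 * (W k ω * (Z k ω - W k ω)) - W k ω ^ 2) ∂P
        = ∫ ω, (Z k ω - W k ω) ^ 2 ∂P := integral_congr_ae (ae_of_all _ fun ω => by ring)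
    have hI : Integrable (fun ω => 2 * (W k ω * (Z k ω - W k ω))) P :=
      ((hW2 k).integrable_mul (hsub k)).const_mul 2
    have hI' : Integrable (fun ω => Z k ω ^ 2 - 2 * (W k ω * (Z k ω - W k ω))) P :=
      (hZ2 k).integrable_sq.sub hI
    rw [← h2, integral_sub hI' (hW2 k).integrable_sq,
      integral_sub (hZ2 k).integrable_sq hI, integral_const_mul, h1]
    have : 0 ≤ ∫ ω, W k ω ^ 2 ∂P := integral_nonneg fun _ => sq_nonneg _
    linarith
  have hSm : ∀ K, Measurable[m K] fun ω => ∑ k ∈ Finset.range K, (Z k ω - W k ω) := fun K =>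
    Finset.measurable_fun_sum _ fun k hk =>
      ((hZ k).mono (hmono (Finset.mem_range.1 hk)) le_rfl).sub
        ((hW k).mono (hmono (Finset.mem_range.1 hk).le) le_rfl)
  refine ae_tendsto_div_of_integral_sq_le (C := C) hS (fun K => ?_) fun K => ?_
  -- The cross term vanishes by orthogonality, so second moments of increments add up to at most `C
  -- * K`.
  · induction K with
    | zero => simp
    | succ K ih =>
      have h2 : ∫ ω, (∑ k ∈ Finset.range (K + 1), (Z k ω - W k ω)) ^ 2 ∂P
          = ∫ ω, ((∑ k ∈ Finset.range K, (Z k ω - W k ω)) ^ 2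
            + 2 * ((∑ k ∈ Finset.range K, (Z k ω - W k ω)) * (Z K ω - W K ω))
            + (Z K ω - W K ω) ^ 2) ∂P :=
        integral_congr_ae (ae_of_all _ fun ω => by
          simp only [Finset.sum_range_succ]; ring)
      have hI : Integrable (fun ω =>
          2 * ((∑ k ∈ Finset.range K, (Z k ω - W k ω)) * (Z K ω - W K ω))) P :=
        ((hS K).integrable_mul (hsub K)).const_mul 2
      have hI' : Integrable (fun ω => (∑ k ∈ Finset.range K, (Z k ω - W k ω)) ^ 2 +
          2 * ((∑ k ∈ Finset.range K, (Z k ω - W k ω)) * (Z K ω - W K ω))) P :=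
        (hS K).integrable_sq.add hI
      rw [h2, integral_add hI' (hsub K).integrable_sq,
        integral_add (hS K).integrable_sq hI, integral_const_mul, horth K _ (hSm K) (hS K)]
      have := hinc K
      push_cast
      linarith
  · simp only [Finset.sum_range_succ, add_sub_cancel_left]
    exact hinc K

/-! ### Second moments of a frame and the constants `B` and `β` -/

namespace System

/-- A bound for the conditional second moments of the increments of queue `n`. -/
def incrementBound {N : ℕ} {M : Type*} (S : System N M) (lam : Fin N → ℝ) (n : Fin N) : ℝ :=
  3 * lam n ^ 2 * S.sigma ^ 2 + 3 * (lam n ^ 2 * S.Imax ^ 2 + 1)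

variable {N : ℕ} {M : Type*} {S : System N M} {Ω : Type*} [MeasurableSpace Ω]
  {P : Measure Ω} {X : Trajectory N M Ω}

namespace IsPolicy

/-- Uses `(a + b - c)² ≤ 3 (a² + b² + c²)` together with `I ≤ Imax` and an indicator of square at
most one. -/
theorem delta_sq_le (h : S.IsPolicy P X) (lam : Fin N → ℝ) (k : ℕ) (n : Fin N) (ω : Ω) :
    X.delta lam k n ω ^ 2 ≤ 3 * lam n ^ 2 * X.D k ω ^ 2 + 3 * (lam n ^ 2 * S.Imax ^ 2 + 1) := by
  obtain ⟨h0, h1⟩ := h.idle_mem k ω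
  have hi : X.ind n k ω ^ 2 ≤ 1 := by rcases X.ind_mem n k ω with h | h <;> rw [h] <;> norm_num
  have hI : lam n ^ 2 * X.I k ω ^ 2 ≤ lam n ^ 2 * S.Imax ^ 2 := by gcongr
  unfold Trajectory.delta
  nlinarith [sq_nonneg (lam n * X.D k ω - lam n * X.I k ω),
    sq_nonneg (lam n * X.D k ω + X.ind n k ω), sq_nonneg (lam n * X.I k ω + X.ind n k ω)]

theorem measurable_queue [Finite M] (h : S.IsPolicy P X) (lam : Fin N → ℝ) (k : ℕ) (n : Fin N) :
    Measurable (X.queue lam k n) :=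
  (X.measurable_queue lam k n).mono (h.past_le k) le_rfl

theorem expAvg_I_nonneg (h : S.IsPolicy P X) (K : ℕ) : 0 ≤ expAvg P X.I K :=
  mul_nonneg (by positivity)
    (Finset.sum_nonneg fun k _ => integral_nonneg fun ω => (h.idle_mem k ω).1)

variable [IsProbabilityMeasure P]

theorem memLp_I (h : S.IsPolicy P X) (k : ℕ) : MemLp (X.I k) 2 P :=
  MemLp.of_bound (h.measurable_I k).aestronglyMeasurable S.Imax (ae_of_all _ fun ω => by
    rw [Real.norm_of_nonneg (h.idle_mem k ω).1]; exact (h.idle_mem k ω).2)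

variable [Finite M]

theorem integrable_D_sq (h : S.IsPolicy P X) (k : ℕ) : Integrable (fun ω => X.D k ω ^ 2) P :=
  h.integrable_comp_outcome k (f := fun x => x.1 ^ 2) fun a => (S.memLp_D k a).integrable_sq

theorem integrable_e_sq (h : S.IsPolicy P X) (k : ℕ) : Integrable (fun ω => X.e k ω ^ 2) P :=
  h.integrable_comp_outcome k (f := fun x => x.2 ^ 2) fun a => (S.memLp_e k a).integrable_sq

theorem memLp_D (h : S.IsPolicy P X) (k : ℕ) : MemLp (X.D k) 2 P :=
  (memLp_two_iff_integrable_sq (h.measurable_D k).aestronglyMeasurable).2 (h.integrable_D_sq k)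

theorem memLp_e (h : S.IsPolicy P X) (k : ℕ) : MemLp (X.e k) 2 P :=
  (memLp_two_iff_integrable_sq (h.measurable_e k).aestronglyMeasurable).2 (h.integrable_e_sq k)

theorem memLp_comp_act (h : S.IsPolicy P X) (k : ℕ) (g : Fin N × M → ℝ) :
    MemLp (fun ω => g (X.act k ω)) 2 P :=
  (memLp_two_iff_integrable_sq (h.measurable_comp_act k g).aestronglyMeasurable).2
    (h.integrable_comp_act k fun a => g a ^ 2)

theorem memLp_ind (h : S.IsPolicy P X) (n : Fin N) (k : ℕ) : MemLp (X.ind n k) 2 P :=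
  h.memLp_comp_act k fun a => if a.1 = n then (1 : ℝ) else 0

theorem memLp_delta (h : S.IsPolicy P X) (lam : Fin N → ℝ) (k : ℕ) (n : Fin N) :
    MemLp (X.delta lam k n) 2 P :=
  (((h.memLp_D k).add (h.memLp_I k)).const_mul (lam n)).sub (h.memLp_ind n k)

theorem memLp_queue (h : S.IsPolicy P X) (lam : Fin N → ℝ) (k : ℕ) (n : Fin N) :
    MemLp (X.queue lam k n) 2 P := by
  induction k with
  | zero => exact memLp_const (0 : ℝ)
  | succ k ih =>
    refine (ih.add (h.memLp_delta lam k n)).mono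
      (h.measurable_queue lam (k + 1) n).aestronglyMeasurable (ae_of_all _ fun ω => ?_)
    rw [X.queue_succ, Pi.add_apply, Real.norm_of_nonneg (le_max_right _ _), Real.norm_eq_abs]
    exact max_le (le_abs_self _) (abs_nonneg _)

theorem condExp_D (h : S.IsPolicy P X) (k : ℕ) :
    P[X.D k | X.pastAction k] =ᵐ[P] fun ω => S.Dhat (X.act k ω) := by
  have := h.condExp_comp_outcome k measurable_fst
    fun a => have := S.isProbabilityMeasure_law k a; (S.memLp_D k a).integrable one_le_two
  simpa only [S.mean_D] using this

theorem condExp_e (h : S.IsPolicy P X) (k : ℕ) :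
    P[X.e k | X.pastAction k] =ᵐ[P] fun ω => S.ehat (X.act k ω) := by
  have := h.condExp_comp_outcome k measurable_snd
    fun a => have := S.isProbabilityMeasure_law k a; (S.memLp_e k a).integrable one_le_two
  simpa only [S.mean_e] using this

/-- `Q[k]` is a function of the past, so the tower property passes the bound down from `pastAction`.
-/
theorem condExp_D_sq_le (h : S.IsPolicy P X) (lam : Fin N → ℝ) (k : ℕ) :
    P[fun ω => X.D k ω ^ 2 | X.queueSigma lam k] ≤ᵐ[P] fun _ => S.sigma ^ 2 := by
  have hm := X.queueSigma_le_pastAction lam k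
  have h1 := h.condExp_comp_outcome k (measurable_fst.pow_const 2)
    fun a => (S.memLp_D k a).integrable_sq
  have h2 : P[P[fun ω => X.D k ω ^ 2 | X.pastAction k] | X.queueSigma lam k]
      ≤ᵐ[P] P[fun _ => S.sigma ^ 2 | X.queueSigma lam k] :=
    condExp_mono integrable_condExp (integrable_const _)
      (h1.trans_le (ae_of_all _ fun ω => S.sq_D_le k _))
  rw [condExp_const (hm.trans (h.pastAction_le k))] at h2
  exact (condExp_condExp_of_le hm (h.pastAction_le k)).symm.trans_le h2

theorem integral_D_sq_le (h : S.IsPolicy P X) (k : ℕ) :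
    ∫ ω, X.D k ω ^ 2 ∂P ≤ S.sigma ^ 2 := by
  have h1 := h.condExp_comp_outcome k (measurable_fst.pow_const 2)
    fun a => (S.memLp_D k a).integrable_sq
  rw [← integral_condExp (h.pastAction_le k)]
  simpa using integral_mono_ae integrable_condExp (integrable_const (S.sigma ^ 2))
    (h1.trans_le (ae_of_all _ fun ω => S.sq_D_le k _))

theorem integral_e_sq_le (h : S.IsPolicy P X) (k : ℕ) :
    ∫ ω, X.e k ω ^ 2 ∂P ≤ S.sigma ^ 2 := by
  have h1 := h.condExp_comp_outcome k (measurable_snd.pow_const 2)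
    fun a => (S.memLp_e k a).integrable_sq
  rw [← integral_condExp (h.pastAction_le k)]
  simpa using integral_mono_ae integrable_condExp (integrable_const (S.sigma ^ 2))
    (h1.trans_le (ae_of_all _ fun ω => S.sq_e_le k _))

theorem integrable_D_sq_const_mul_add (h : S.IsPolicy P X) (k : ℕ) (a b : ℝ) :
    Integrable (fun ω => a * X.D k ω ^ 2 + b) P :=
  ((h.integrable_D_sq k).const_mul a).add (integrable_const b)

theorem condExp_delta_sq_le (h : S.IsPolicy P X) (lam : Fin N → ℝ) (k : ℕ) (n : Fin N) :
    P[fun ω => X.delta lam k n ω ^ 2 | X.queueSigma lam k]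
      ≤ᵐ[P] fun _ => S.incrementBound lam n := by
  have hm := X.queueSigma_le_pastAction lam k
  have h1 := condExp_mono (m := X.queueSigma lam k) (h.memLp_delta lam k n).integrable_sq
    (h.integrable_D_sq_const_mul_add k _ _) (ae_of_all _ fun ω => h.delta_sq_le lam k n ω)
  have h2 : P[fun ω => 3 * lam n ^ 2 * X.D k ω ^ 2 + 3 * (lam n ^ 2 * S.Imax ^ 2 + 1) |
      X.queueSigma lam k] =ᵐ[P] P[fun ω => 3 * lam n ^ 2 * X.D k ω ^ 2 | X.queueSigma lam k]
        + P[fun _ => 3 * (lam n ^ 2 * S.Imax ^ 2 + 1) | X.queueSigma lam k] :=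
    condExp_add ((h.integrable_D_sq k).const_mul _) (integrable_const _) _
  rw [condExp_const (hm.trans (h.pastAction_le k))] at h2
  have h3 : P[fun ω => 3 * lam n ^ 2 * X.D k ω ^ 2 | X.queueSigma lam k]
      =ᵐ[P] (3 * lam n ^ 2) • P[fun ω => X.D k ω ^ 2 | X.queueSigma lam k] :=
    condExp_smul (3 * lam n ^ 2) (fun ω => X.D k ω ^ 2) _
  filter_upwards [h1, h2, h3, h.condExp_D_sq_le lam k] with ω h1 h2 h3 h4
  rw [h2, Pi.add_apply, h3, Pi.smul_apply, smul_eq_mul] at h1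
  refine h1.trans ?_
  unfold incrementBound
  gcongr

theorem integral_delta_sq_le (h : S.IsPolicy P X) (lam : Fin N → ℝ) (k : ℕ) (n : Fin N) :
    ∫ ω, X.delta lam k n ω ^ 2 ∂P ≤ S.incrementBound lam n := by
  rw [← integral_condExp ((X.queueSigma_le_pastAction lam k).trans (h.pastAction_le k))]
  simpa using integral_mono_ae integrable_condExp (integrable_const (S.incrementBound lam n))
    (h.condExp_delta_sq_le lam k n)

theorem isDriftBound (h : S.IsPolicy P X) (lam : Fin N → ℝ) :
    IsDriftBound P lam X ((1 / 2) * ∑ n, S.incrementBound lam n) := by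
  intro k
  have := fun n => h.condExp_delta_sq_le lam k n
  filter_upwards [ae_all_iff.2 this] with ω hω
  exact mul_le_mul_of_nonneg_left (Finset.sum_le_sum fun n _ => hω n) (by norm_num)

/-- A drift bound also bounds the unconditional second moments of the increments. -/
theorem sum_integral_delta_sq_le (h : S.IsPolicy P X) {lam : Fin N → ℝ} {B : ℝ}
    (hB : IsDriftBound P lam X B) (k : ℕ) :
    (1 / 2) * ∑ n, ∫ ω, X.delta lam k n ω ^ 2 ∂P ≤ B := by
  have hle := (X.queueSigma_le_pastAction lam k).trans (h.pastAction_le k)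
  have hI : Integrable (fun ω =>
      (1 / 2) * ∑ n, (P[fun ω' => X.delta lam k n ω' ^ 2 | X.queueSigma lam k]) ω) P :=
    (integrable_finsetSum _ fun n _ => integrable_condExp).const_mul _
  have h1 := integral_mono_ae hI (integrable_const B) (hB k)
  rw [integral_const_mul, integral_finsetSum _ fun n _ => integrable_condExp] at h1
  simpa [integral_condExp hle] using h1

/-- Linear terms are dominated by second moments plus constants, in the style of `|x| ≤ x² + 1`. The
resulting constant is crude but depends only on `S` and `lam`, not on the policy. -/
theorem isPenaltyBound (h : S.IsPolicy P X) (lam : Fin N → ℝ) :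
    S.IsPenaltyBound P lam X
      (|S.powerOpt lam| * S.sigma ^ 2 + (|S.powerOpt lam| * (1 + S.Imax) + 1) + S.sigma ^ 2) := by
  intro k
  have hD := h.integrable_D_sq_const_mul_add k |S.powerOpt lam| (|S.powerOpt lam| * (1 + S.Imax) + 1)
  have he := h.integrable_e_sq k
  have h1 : ∫ ω, (S.powerOpt lam * (X.D k ω + X.I k ω) - X.e k ω) ∂P
      ≤ ∫ ω, ((|S.powerOpt lam| * X.D k ω ^ 2 + (|S.powerOpt lam| * (1 + S.Imax) + 1))
        + X.e k ω ^ 2) ∂P := by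
    refine integral_mono
      (((((h.memLp_D k).add (h.memLp_I k)).integrable one_le_two).const_mul _).sub
        ((h.memLp_e k).integrable one_le_two)) (hD.add he) fun ω => ?_
    obtain ⟨hI0, hI1⟩ := h.idle_mem k ω
    have h2 : |X.D k ω + X.I k ω| ≤ X.D k ω ^ 2 + (1 + S.Imax) := by
      rw [abs_le]
      constructor <;> nlinarith [sq_nonneg (X.D k ω - 1), sq_nonneg (X.D k ω + 1)]
    have h3 : S.powerOpt lam * (X.D k ω + X.I k ω)
        ≤ |S.powerOpt lam| * (X.D k ω ^ 2 + (1 + S.Imax)) :=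
      (le_abs_self _).trans (by rw [abs_mul]; gcongr)
    have h4 : -X.e k ω ≤ X.e k ω ^ 2 + 1 := by nlinarith [sq_nonneg (X.e k ω + 1)]
    simp only
    linarith
  rw [integral_add hD he, integral_add ((h.integrable_D_sq k).const_mul _) (integrable_const _),
    integral_const_mul] at h1
  simp only [integral_const, probReal_univ, one_smul] at h1
  refine h1.trans ?_
  have h2 := h.integral_D_sq_le k
  have h3 := h.integral_e_sq_le k
  gcongr

theorem ae_tendsto_D_sub_Dhat (h : S.IsPolicy P X) : ∀ᵐ ω ∂P, Tendsto (fun K : ℕ =>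
    (∑ k ∈ Finset.range K, (X.D k ω - S.Dhat (X.act k ω))) / K) atTop (𝓝 0) :=
  ae_tendsto_sum_sub_condExp_div h.pastAction_le X.pastAction_mono
    (fun k => (X.measurable_D_past (Nat.lt_succ_self k)).mono (X.past_le_pastAction _) le_rfl)
    (fun k => X.measurable_comp_act k _) h.memLp_D (fun k => h.memLp_comp_act k _) h.condExp_D
    h.integral_D_sq_le

theorem ae_tendsto_e_sub_ehat (h : S.IsPolicy P X) : ∀ᵐ ω ∂P, Tendsto (fun K : ℕ =>
    (∑ k ∈ Finset.range K, (X.e k ω - S.ehat (X.act k ω))) / K) atTop (𝓝 0) :=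
  ae_tendsto_sum_sub_condExp_div h.pastAction_le X.pastAction_mono
    (fun k => (X.measurable_e_past (Nat.lt_succ_self k)).mono (X.past_le_pastAction _) le_rfl)
    (fun k => X.measurable_comp_act k _) h.memLp_e (fun k => h.memLp_comp_act k _) h.condExp_e
    h.integral_e_sq_le

end IsPolicy
end System

/-! ### Comparison of one-frame ratios with feasible policies -/

theorem frameAvg_eq_div {Ω : Type*} (f : ℕ → Ω → ℝ) (K : ℕ) (ω : Ω) :
    frameAvg f K ω = (∑ k ∈ Finset.range K, f k ω) / K := by
  rw [frameAvg, one_div, inv_mul_eq_div]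

namespace Trajectory

theorem sum_mul_ind {N : ℕ} {M Ω : Type*} (X : Trajectory N M Ω) (q : Fin N → ℝ) (k : ℕ) (ω : Ω) :
    ∑ n, q n * X.ind n k ω = q (X.c k ω) := by
  simp [ind]

end Trajectory

namespace System

variable {N : ℕ} {M : Type*} [Finite M] {S : System N M}

/-- Every feasible power `p` dominates the minimal drift-plus-penalty ratio. -/
theorem IsFeasiblePower.ratio_add_le {lam : Fin N → ℝ} {p : ℝ} (hp : S.IsFeasiblePower lam p)
    {V : ℝ} {q : Fin N → ℝ} (hq : ∀ n, 0 ≤ q n) {r : ℝ}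
    (hr : ∀ (a : Fin N × M) (I : ℝ), I ∈ Set.Icc 0 S.Imax →
      r ≤ (V * S.ehat a - q a.1) / (S.Dhat a + I)) :
    r + ∑ n, q n * lam n ≤ V * p := by
  obtain ⟨Ω, _, P, _, X, ebar, Dbar, Ibar, onebar, hX, he, hD, hI, hone, hlam, rfl⟩ := hp
  -- All limits are almost sure, so one outcome has them all; the rest is deterministic.
  obtain ⟨ω, he, hD, hI, hone, hD', he'⟩ := (he.and (hD.and (hI.and ((ae_all_iff.2 hone).and
    (hX.ae_tendsto_D_sub_Dhat.and hX.ae_tendsto_e_sub_ehat))))).exists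
  simp only [frameAvg_eq_div] at he hD hI hone
  have hDhat : Tendsto (fun K : ℕ => (∑ k ∈ Finset.range K, S.Dhat (X.act k ω)) / (K : ℝ)) atTop
      (𝓝 Dbar) := by
    simpa [Finset.sum_sub_distrib, sub_div] using hD.sub hD'
  have hehat : Tendsto (fun K : ℕ => (∑ k ∈ Finset.range K, S.ehat (X.act k ω)) / (K : ℝ)) atTop
      (𝓝 ebar) := by
    simpa [Finset.sum_sub_distrib, sub_div] using he.sub he'
  -- The bound passes through `Dhat`, which exceeds `Dmin` for every decision, not only almost
  -- surely.
  have hDbar : S.Dmin ≤ Dbar := by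
    refine ge_of_tendsto hDhat ?_
    filter_upwards [eventually_ge_atTop 1] with K hK
    have hK' : (0 : ℝ) < K := by exact_mod_cast hK
    rw [le_div_iff₀ hK']
    have := Finset.card_nsmul_le_sum (Finset.range K) (fun k => S.Dhat (X.act k ω)) S.Dmin
      fun k _ => S.Dmin_le_Dhat _
    simpa [mul_comm] using this
  have hIbar : 0 ≤ Ibar := ge_of_tendsto' hI fun K =>
    div_nonneg (Finset.sum_nonneg fun k _ => (hX.idle_mem k ω).1) (Nat.cast_nonneg K)
  have hT : 0 < Dbar + Ibar := by linarith [S.Dmin_pos]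
  -- The hypothesis `hr` applies to each frame of the competing policy; sum over frames, divide by
  -- `K` and let `K → ∞`.
  have hlim : r * (Dbar + Ibar) ≤ V * ebar - ∑ n, q n * onebar n := by
    refine le_of_tendsto_of_tendsto' ((hDhat.add hI).const_mul r) ((hehat.const_mul V).sub
      (tendsto_finsetSum _ fun n _ => (hone n).const_mul (q n))) fun K => ?_
    have h1 : ∀ k, r * (S.Dhat (X.act k ω) + X.I k ω)
        ≤ V * S.ehat (X.act k ω) - ∑ n, q n * X.ind n k ω := fun k => by
      have h2 := hr (X.act k ω) _ (hX.idle_mem k ω)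
      rw [X.sum_mul_ind]
      rwa [le_div_iff₀ (add_pos_of_pos_of_nonneg (S.Dhat_pos _) (hX.idle_mem k ω).1)] at h2
    have h2 := Finset.sum_le_sum fun k (_ : k ∈ Finset.range K) => h1 k
    rw [← Finset.mul_sum, Finset.sum_add_distrib, Finset.sum_sub_distrib, ← Finset.mul_sum,
      Finset.sum_comm] at h2
    simp only [← Finset.mul_sum] at h2
    have h3 := div_le_div_of_nonneg_right h2 (Nat.cast_nonneg K)
    simpa only [sub_div, add_div, mul_div_assoc, Finset.sum_div] using h3
  have hsum : (∑ n, q n * lam n) * (Dbar + Ibar) ≤ ∑ n, q n * onebar n := by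
    rw [Finset.sum_mul]
    refine Finset.sum_le_sum fun n _ => ?_
    rw [mul_assoc]
    exact mul_le_mul_of_nonneg_left ((le_div_iff₀ hT).1 (hlam n)) (hq n)
  rw [← mul_div_assoc, le_div_iff₀ hT]
  linarith

/-- For `V > 0`, divide by `V` and take the infimum over `p`. For `V = 0` the bound does not involve
`p`, and one feasible policy is enough. -/
theorem Feasible.ratio_add_le {lam : Fin N → ℝ} (hfeas : S.Feasible lam)
    {V : ℝ} (hV : 0 ≤ V) {q : Fin N → ℝ} (hq : ∀ n, 0 ≤ q n) {r : ℝ}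
    (hr : ∀ (a : Fin N × M) (I : ℝ), I ∈ Set.Icc 0 S.Imax →
      r ≤ (V * S.ehat a - q a.1) / (S.Dhat a + I)) :
    r + ∑ n, q n * lam n ≤ V * S.powerOpt lam := by
  have h : ∀ p, S.IsFeasiblePower lam p → r + ∑ n, q n * lam n ≤ V * p :=
    fun p hp => hp.ratio_add_le hq hr
  rcases hV.eq_or_lt with rfl | hV
  · obtain ⟨p, hp⟩ := hfeas
    simpa using h p hp
  · rw [mul_comm, ← div_le_iff₀ hV]
    exact le_csInf hfeas fun p hp => by
      rw [div_le_iff₀ hV, mul_comm]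
      exact h p hp

variable {Ω : Type*} [MeasurableSpace Ω] {P : Measure Ω} {X : Trajectory N M Ω}
  {lam : Fin N → ℝ} {V : ℝ}

/-- The drift-plus-penalty inequality on a frame, with the outcomes `D[k]` and `e[k]` replaced by
their conditional means. -/
theorem IsAlgorithm.drift_plus_penalty_le (h : S.IsAlgorithm lam V P X) (hfeas : S.Feasible lam)
    (hV : 0 ≤ V) (k : ℕ) (ω : Ω) :
    ∑ n, X.queue lam k n ω *
        (lam n * (S.Dhat (X.act k ω) + X.I k ω) - X.ind n k ω) + V * S.ehat (X.act k ω)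
      ≤ V * S.powerOpt lam * (S.Dhat (X.act k ω) + X.I k ω) := by
  have hT : 0 < S.Dhat (X.act k ω) + X.I k ω :=
    add_pos_of_pos_of_nonneg (S.Dhat_pos _) (h.idle_mem k ω).1
  -- Here `r` is the ratio attained by the algorithm, and the weights are the current queues.
  have h1 := hfeas.ratio_add_le hV (fun n => X.queue_nonneg lam k n ω)
    fun a I hI => h.minimizes k ω a.1 a.2 I hI
  have h2 := mul_le_mul_of_nonneg_right h1 hT.le
  have hact : X.act k ω = (X.c k ω, X.m k ω) := rfl
  rw [add_mul, ← hact, div_mul_cancel₀ _ hT.ne', Finset.sum_mul] at h2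
  refine le_trans (le_of_eq ?_) h2
  rw [← X.sum_mul_ind (fun n => X.queue lam k n ω) k ω]
  simp only [mul_sub, Finset.sum_sub_distrib, mul_assoc]
  ring

/-! ### Lyapunov drift in expectation -/

namespace IsPolicy

variable [IsProbabilityMeasure P]

/-- Only `D[k]` is replaced by its conditional mean, as `Q[k]` is determined by the past. `I[k]`
stays as it is, since it may depend on `D[k]`. -/
theorem integral_queue_mul_delta (h : S.IsPolicy P X) (lam : Fin N → ℝ) (k : ℕ) (n : Fin N) :
    ∫ ω, X.queue lam k n ω * X.delta lam k n ω ∂P = ∫ ω, X.queue lam k n ω *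
        (lam n * (S.Dhat (X.act k ω) + X.I k ω) - X.ind n k ω) ∂P := by
  have hQ := h.memLp_queue lam k n
  have hQD : Integrable (fun ω => X.queue lam k n ω * X.D k ω) P := hQ.integrable_mul (h.memLp_D k)
  have hQD' : Integrable (fun ω => X.queue lam k n ω * S.Dhat (X.act k ω)) P :=
    hQ.integrable_mul (h.memLp_comp_act k S.Dhat)
  have hR : Integrable (fun ω => X.queue lam k n ω * (lam n * X.I k ω - X.ind n k ω)) P :=
    hQ.integrable_mul (((h.memLp_I k).const_mul (lam n)).sub (h.memLp_ind n k))
  have h1 := integral_mul_eq_of_condExp_ae_eq (h.pastAction_le k)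
    ((X.measurable_queue lam k n).mono (X.past_le_pastAction k) le_rfl) hQ (h.memLp_D k)
    (h.condExp_D k)
  calc ∫ ω, X.queue lam k n ω * X.delta lam k n ω ∂P
      = ∫ ω, (lam n * (X.queue lam k n ω * X.D k ω)
          + X.queue lam k n ω * (lam n * X.I k ω - X.ind n k ω)) ∂P :=
        integral_congr_ae (ae_of_all _ fun ω => by simp only [Trajectory.delta]; ring)
    _ = ∫ ω, (lam n * (X.queue lam k n ω * S.Dhat (X.act k ω))
          + X.queue lam k n ω * (lam n * X.I k ω - X.ind n k ω)) ∂P := by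
        rw [integral_add (hQD.const_mul _) hR, integral_add (hQD'.const_mul _) hR,
          integral_const_mul, integral_const_mul, h1]
    _ = _ := integral_congr_ae (ae_of_all _ fun ω => by ring)

theorem integral_D (h : S.IsPolicy P X) (k : ℕ) :
    ∫ ω, X.D k ω ∂P = ∫ ω, S.Dhat (X.act k ω) ∂P := by
  rw [← integral_condExp (h.pastAction_le k)]
  exact integral_congr_ae (h.condExp_D k)

theorem integral_e (h : S.IsPolicy P X) (k : ℕ) :
    ∫ ω, X.e k ω ∂P = ∫ ω, S.ehat (X.act k ω) ∂P := by
  rw [← integral_condExp (h.pastAction_le k)]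
  exact integral_congr_ae (h.condExp_e k)

theorem integral_queue_succ_sq_le (h : S.IsPolicy P X) (lam : Fin N → ℝ) (k : ℕ) (n : Fin N) :
    ∫ ω, X.queue lam (k + 1) n ω ^ 2 ∂P ≤ ∫ ω, X.queue lam k n ω ^ 2 ∂P
      + 2 * ∫ ω, X.queue lam k n ω * X.delta lam k n ω ∂P
      + ∫ ω, X.delta lam k n ω ^ 2 ∂P := by
  have h1 := (h.memLp_queue lam k n).integrable_sq
  have h2 : Integrable (fun ω => 2 * (X.queue lam k n ω * X.delta lam k n ω)) P :=
    ((h.memLp_queue lam k n).integrable_mul (h.memLp_delta lam k n)).const_mul 2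
  have h3 := (h.memLp_delta lam k n).integrable_sq
  have h12 : Integrable (fun ω => X.queue lam k n ω ^ 2
      + 2 * (X.queue lam k n ω * X.delta lam k n ω)) P := h1.add h2
  rw [← integral_const_mul, ← integral_add h1 h2, ← integral_add h12 h3]
  exact integral_mono (h.memLp_queue lam (k + 1) n).integrable_sq (h12.add h3)
    fun ω => X.queue_succ_sq_le lam k n ω

end IsPolicy

namespace IsAlgorithm

variable [IsProbabilityMeasure P]

theorem sum_integral_queue_mul_delta_le (h : S.IsAlgorithm lam V P X) (hfeas : S.Feasible lam)
    (hV : 0 ≤ V) (k : ℕ) :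
    ∑ n, ∫ ω, X.queue lam k n ω * X.delta lam k n ω ∂P
      ≤ V * (S.powerOpt lam * (∫ ω, X.D k ω ∂P + ∫ ω, X.I k ω ∂P) - ∫ ω, X.e k ω ∂P) := by
  have hp := h.toIsPolicy
  have hI := (hp.memLp_I k).integrable one_le_two
  have hDh := hp.integrable_comp_act k S.Dhat
  have heh := (hp.integrable_comp_act k S.ehat).const_mul V
  have hQ : ∀ n ∈ Finset.univ, Integrable (fun ω => X.queue lam k n ω *
      (lam n * (S.Dhat (X.act k ω) + X.I k ω) - X.ind n k ω)) P := fun n _ =>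
    (hp.memLp_queue lam k n).integrable_mul
      ((((hp.memLp_comp_act k S.Dhat).add (hp.memLp_I k)).const_mul (lam n)).sub
        (hp.memLp_ind n k))
  have h1 := integral_mono ((integrable_finsetSum _ hQ).add heh)
    ((hDh.add hI).const_mul (V * S.powerOpt lam))
    fun ω => h.drift_plus_penalty_le hfeas hV k ω
  rw [integral_add' (integrable_finsetSum _ hQ) heh, integral_finsetSum _ hQ, integral_const_mul,
    integral_const_mul, integral_add' hDh hI, ← hp.integral_D, ← hp.integral_e,
    ← Finset.sum_congr rfl fun n _ => hp.integral_queue_mul_delta lam k n] at h1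
  linarith

/-- Telescoped drift-plus-penalty inequality. -/
theorem sum_integral_queue_sq_le (h : S.IsAlgorithm lam V P X) (hfeas : S.Feasible lam)
    (hV : 0 ≤ V) {B : ℝ} (hB : IsDriftBound P lam X B) (K : ℕ) :
    (1 / 2) * ∑ n, ∫ ω, X.queue lam K n ω ^ 2 ∂P ≤ K * B + V * ∑ k ∈ Finset.range K,
      (S.powerOpt lam * (∫ ω, X.D k ω ∂P + ∫ ω, X.I k ω ∂P) - ∫ ω, X.e k ω ∂P) := by
  induction K with
  | zero => simp [Trajectory.queue]
  | succ K ih =>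
    have h1 := Finset.sum_le_sum fun n (_ : n ∈ Finset.univ) =>
      h.toIsPolicy.integral_queue_succ_sq_le lam K n
    rw [Finset.sum_add_distrib, Finset.sum_add_distrib, ← Finset.mul_sum] at h1
    have h2 := h.sum_integral_queue_mul_delta_le hfeas hV K
    have h3 := h.toIsPolicy.sum_integral_delta_sq_le hB K
    rw [Finset.sum_range_succ]
    push_cast
    linarith

/-- Each penalty term in the telescoped inequality is at most `β`; multiplying by `V` needs `0 ≤ V`.
-/
theorem sum_integral_queue_sq_le_of_isPenaltyBound (h : S.IsAlgorithm lam V P X)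
    (hfeas : S.Feasible lam) (hV : 0 ≤ V) {B β : ℝ} (hB : IsDriftBound P lam X B)
    (hβ : S.IsPenaltyBound P lam X β) (K : ℕ) :
    ∑ n, ∫ ω, X.queue lam K n ω ^ 2 ∂P ≤ 2 * (B + V * β) * K := by
  have h1 := h.sum_integral_queue_sq_le hfeas hV hB K
  have h2 : ∀ k, S.powerOpt lam * (∫ ω, X.D k ω ∂P + ∫ ω, X.I k ω ∂P) - ∫ ω, X.e k ω ∂P ≤ β := by
    intro k
    have hD := (h.memLp_D k).integrable one_le_two
    have hI := (h.memLp_I k).integrable one_le_two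
    have := hβ k
    have hDI : Integrable (fun ω => S.powerOpt lam * (X.D k ω + X.I k ω)) P :=
      (hD.add hI).const_mul _
    rwa [integral_sub hDI ((h.memLp_e k).integrable one_le_two), integral_const_mul,
      integral_add hD hI] at this
  have h3 := Finset.sum_le_card_nsmul (Finset.range K) _ β fun k _ => h2 k
  rw [Finset.card_range, nsmul_eq_mul] at h3
  have h4 := mul_le_mul_of_nonneg_left h3 hV
  linarith

end IsAlgorithm

end System

/-! ### Performance bounds and stability -/

theorem sq_integral_le_integral_sq {Ω : Type*} [MeasurableSpace Ω] {P : Measure Ω}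
    [IsProbabilityMeasure P] {Y : Ω → ℝ} (hY : MemLp Y 2 P) :
    (∫ ω, Y ω ∂P) ^ 2 ≤ ∫ ω, Y ω ^ 2 ∂P := by
  have h := ProbabilityTheory.variance_nonneg Y P
  rw [ProbabilityTheory.variance_eq_sub hY] at h
  simpa using h

/-- Taken in `EReal` so that the limsup is meaningful without any lower bound on `a`. -/
theorem limsup_coe_le_zero_of_le {a b : ℕ → ℝ} (hab : ∀ K, a K ≤ b K)
    (hb : Tendsto b atTop (𝓝 0)) : limsup (fun K => (a K : EReal)) atTop ≤ 0 := by
  have h : Tendsto (fun K => (b K : EReal)) atTop (𝓝 ((0 : ℝ) : EReal)) := EReal.tendsto_coe.2 hb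
  rw [← EReal.coe_zero, ← h.limsup_eq]
  exact limsup_le_limsup (Eventually.of_forall fun K => EReal.coe_le_coe_iff.2 (hab K))

theorem Trajectory.queueNorm_sq {N : ℕ} {M Ω : Type*} (X : Trajectory N M Ω) (lam : Fin N → ℝ)
    (k : ℕ) (ω : Ω) : X.queueNorm lam k ω ^ 2 = ∑ n, X.queue lam k n ω ^ 2 :=
  Real.sq_sqrt (Finset.sum_nonneg fun _ _ => sq_nonneg _)

namespace System

variable {N : ℕ} {M : Type*} [Finite M] {S : System N M}
  {Ω : Type*} [MeasurableSpace Ω] {P : Measure Ω} [IsProbabilityMeasure P]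
  {X : Trajectory N M Ω} {lam : Fin N → ℝ} {V : ℝ}

namespace IsPolicy

theorem memLp_queueNorm (h : S.IsPolicy P X) (lam : Fin N → ℝ) (k : ℕ) :
    MemLp (X.queueNorm lam k) 2 P := by
  have hm : Measurable (X.queueNorm lam k) :=
    (Finset.measurable_fun_sum _ fun n _ => (h.measurable_queue lam k n).pow_const 2).sqrt
  rw [memLp_two_iff_integrable_sq hm.aestronglyMeasurable]
  simp only [X.queueNorm_sq]
  exact integrable_finsetSum _ fun n _ => (h.memLp_queue lam k n).integrable_sq

theorem Dmin_le_expAvg_D (h : S.IsPolicy P X) {K : ℕ} (hK : 1 ≤ K) :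
    S.Dmin ≤ expAvg P X.D K := by
  have hK' : (0 : ℝ) < K := by exact_mod_cast hK
  have h1 : ∀ k, S.Dmin ≤ ∫ ω, X.D k ω ∂P := fun k => by
    rw [h.integral_D]
    simpa using integral_mono (integrable_const S.Dmin) (h.integrable_comp_act k S.Dhat)
      fun ω => S.Dmin_le_Dhat (X.act k ω)
  have h2 := Finset.card_nsmul_le_sum (Finset.range K) _ S.Dmin fun k _ => h1 k
  rw [Finset.card_range, nsmul_eq_mul] at h2
  rw [expAvg, one_div, inv_mul_eq_div, le_div_iff₀ hK']
  linarith

theorem expAvg_delta (h : S.IsPolicy P X) (lam : Fin N → ℝ) (n : Fin N) (K : ℕ) :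
    lam n * (expAvg P X.D K + expAvg P X.I K) - expAvg P (X.ind n) K
      = (∫ ω, ∑ k ∈ Finset.range K, X.delta lam k n ω ∂P) / K := by
  have hD := fun k => (h.memLp_D k).integrable one_le_two
  have hI := fun k => (h.memLp_I k).integrable one_le_two
  have hind := fun k => (h.memLp_ind n k).integrable one_le_two
  rw [integral_finsetSum _ fun k _ => (h.memLp_delta lam k n).integrable one_le_two]
  have h1 : ∀ k, ∫ ω, X.delta lam k n ω ∂P
      = lam n * (∫ ω, X.D k ω ∂P + ∫ ω, X.I k ω ∂P) - ∫ ω, X.ind n k ω ∂P := fun k => by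
    have hDI : Integrable (fun ω => lam n * (X.D k ω + X.I k ω)) P :=
      ((hD k).add (hI k)).const_mul _
    unfold Trajectory.delta
    rw [integral_sub hDI (hind k), integral_const_mul, integral_add (hD k) (hI k)]
  simp only [h1, expAvg, Finset.sum_sub_distrib, ← Finset.mul_sum, Finset.sum_add_distrib]
  ring

theorem integral_queue_sub_sq_le (h : S.IsPolicy P X) (lam : Fin N → ℝ) (k : ℕ) (n : Fin N) :
    ∫ ω, (X.queue lam (k + 1) n ω - X.queue lam k n ω) ^ 2 ∂P ≤ S.incrementBound lam n :=
  (integral_mono ((h.memLp_queue lam (k + 1) n).sub (h.memLp_queue lam k n)).integrable_sq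
    (h.memLp_delta lam k n).integrable_sq
    fun ω => sq_le_sq.2 (X.abs_queue_succ_sub_le lam k n ω)).trans (h.integral_delta_sq_le lam k n)

end IsPolicy

namespace IsAlgorithm

/-- Drop the nonnegative queue term from the telescoped inequality and divide by `K`, by `V` and by
the mean frame length, which is positive because of `Dmin`. -/
theorem averagePower_le (h : S.IsAlgorithm lam V P X) (hfeas : S.Feasible lam) (hV : 0 < V) {B : ℝ}
    (hB : IsDriftBound P lam X B) {K : ℕ} (hK : 1 ≤ K) :
    expAvg P X.e K / (expAvg P X.D K + expAvg P X.I K)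
      ≤ S.powerOpt lam + B / (V * (expAvg P X.D K + expAvg P X.I K)) := by
  have hK' : (0 : ℝ) < K := by exact_mod_cast hK
  have hT : 0 < expAvg P X.D K + expAvg P X.I K := by
    linarith [h.Dmin_le_expAvg_D hK, h.expAvg_I_nonneg K, S.Dmin_pos]
  have h1 := h.sum_integral_queue_sq_le hfeas hV.le hB K
  have h0 : 0 ≤ (1 / 2) * ∑ n, ∫ ω, X.queue lam K n ω ^ 2 ∂P :=
    mul_nonneg (by norm_num) (Finset.sum_nonneg fun n _ => integral_nonneg fun _ => sq_nonneg _)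
  have h2 : K * B + V * ∑ k ∈ Finset.range K,
      (S.powerOpt lam * (∫ ω, X.D k ω ∂P + ∫ ω, X.I k ω ∂P) - ∫ ω, X.e k ω ∂P)
      = K * (B + V * (S.powerOpt lam * (expAvg P X.D K + expAvg P X.I K) - expAvg P X.e K)) := by
    simp only [expAvg, Finset.sum_sub_distrib, ← Finset.mul_sum, Finset.sum_add_distrib]
    field_simp
  have h3 := nonneg_of_mul_nonneg_right (h2 ▸ h0.trans h1) hK'
  rw [← div_div, div_le_iff₀ hT, add_mul, div_mul_cancel₀ _ hT.ne', ← sub_le_iff_le_add',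
    le_div_iff₀ hV]
  linarith

/-- Jensen's inequality `(E‖Q‖)² ≤ E‖Q‖²`, applied to the linear growth bound. -/
theorem integral_queueNorm_div_le (h : S.IsAlgorithm lam V P X) (hfeas : S.Feasible lam)
    (hV : 0 ≤ V) {B β : ℝ} (hB : IsDriftBound P lam X B) (hβ : S.IsPenaltyBound P lam X β)
    {K : ℕ} (hK : 1 ≤ K) :
    (∫ ω, X.queueNorm lam K ω ∂P) / K ≤ Real.sqrt (2 * (B + V * β) / K) := by
  have hK' : (0 : ℝ) < K := by exact_mod_cast hK
  refine Real.le_sqrt_of_sq_le ?_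
  have h1 := sq_integral_le_integral_sq (h.memLp_queueNorm lam K)
  simp only [X.queueNorm_sq] at h1
  rw [integral_finsetSum _ fun n _ => (h.memLp_queue lam K n).integrable_sq] at h1
  have h2 := h1.trans (h.sum_integral_queue_sq_le_of_isPenaltyBound hfeas hV hB hβ K)
  rw [div_pow, div_le_div_iff₀ (by positivity) hK']
  nlinarith

/-- Stability must not presuppose given `B` and `β`, so the uniform constants valid for every policy
are inserted. -/
theorem exists_integral_queue_sq_le (h : S.IsAlgorithm lam V P X) (hfeas : S.Feasible lam)
    (hV : 0 ≤ V) : ∃ C : ℝ, ∀ (n : Fin N) (K : ℕ), ∫ ω, X.queue lam K n ω ^ 2 ∂P ≤ C * K :=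
  ⟨_, fun n K => (Finset.single_le_sum (f := fun n => ∫ ω, X.queue lam K n ω ^ 2 ∂P)
    (fun _ _ => integral_nonneg fun _ => sq_nonneg _) (Finset.mem_univ n)).trans
    (h.sum_integral_queue_sq_le_of_isPenaltyBound hfeas hV (h.isDriftBound lam)
      (h.isPenaltyBound lam) K)⟩

theorem tendsto_integral_queue_div (h : S.IsAlgorithm lam V P X) (hfeas : S.Feasible lam)
    (hV : 0 ≤ V) (n : Fin N) :
    Tendsto (fun K : ℕ => (∫ ω, X.queue lam K n ω ∂P) / K) atTop (𝓝 0) := by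
  obtain ⟨C, hC⟩ := h.exists_integral_queue_sq_le hfeas hV
  have hlim : Tendsto (fun K : ℕ => Real.sqrt (C / K)) atTop (𝓝 0) := by
    simpa using (tendsto_const_div_atTop_nhds_zero_nat C).sqrt
  refine squeeze_zero (fun K => div_nonneg (integral_nonneg fun ω => X.queue_nonneg lam K n ω)
    (Nat.cast_nonneg K)) (fun K => ?_) hlim
  rcases K.eq_zero_or_pos with rfl | hK
  · simp
  have hK' : (0 : ℝ) < K := by exact_mod_cast hK
  refine Real.le_sqrt_of_sq_le ?_
  have h2 := (sq_integral_le_integral_sq (h.memLp_queue lam K n)).trans (hC n K)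
  rw [div_pow, div_le_div_iff₀ (by positivity) hK']
  nlinarith

theorem ae_tendsto_queue_div (h : S.IsAlgorithm lam V P X) (hfeas : S.Feasible lam)
    (hV : 0 ≤ V) (n : Fin N) :
    ∀ᵐ ω ∂P, Tendsto (fun K : ℕ => X.queue lam K n ω / K) atTop (𝓝 0) := by
  obtain ⟨C, hC⟩ := h.exists_integral_queue_sq_le hfeas hV
  -- One constant must serve both the growth bound and the increment bound, hence the maximum.
  refine ae_tendsto_div_of_integral_sq_le (C := max C (S.incrementBound lam n))
    (fun K => h.memLp_queue lam K n) (fun K => (hC n K).trans ?_)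
    fun K => (h.integral_queue_sub_sq_le lam K n).trans (le_max_right _ _)
  exact mul_le_mul_of_nonneg_right (le_max_left _ _) (Nat.cast_nonneg K)

theorem limsup_expAvg_le (h : S.IsAlgorithm lam V P X) (hfeas : S.Feasible lam)
    (hV : 0 ≤ V) (n : Fin N) :
    limsup (fun K : ℕ => ((lam n * (expAvg P X.D K + expAvg P X.I K)
      - expAvg P (X.ind n) K : ℝ) : EReal)) atTop ≤ 0 := by
  refine limsup_coe_le_zero_of_le (fun K => ?_) (h.tendsto_integral_queue_div hfeas hV n)
  rw [h.expAvg_delta]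
  refine div_le_div_of_nonneg_right (integral_mono
    (integrable_finsetSum _ fun k _ => (h.memLp_delta lam k n).integrable one_le_two)
    ((h.memLp_queue lam K n).integrable one_le_two)
    fun ω => X.sum_delta_le_queue lam K n ω) (Nat.cast_nonneg K)

theorem ae_limsup_frameAvg_le (h : S.IsAlgorithm lam V P X) (hfeas : S.Feasible lam)
    (hV : 0 ≤ V) (n : Fin N) :
    ∀ᵐ ω ∂P, limsup (fun K : ℕ => ((frameAvg
      (fun k ω' => lam n * (X.D k ω' + X.I k ω') - X.ind n k ω') K ω : ℝ) : EReal)) atTop ≤ 0 := by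
  filter_upwards [h.ae_tendsto_queue_div hfeas hV n] with ω hω
  refine limsup_coe_le_zero_of_le (fun K => ?_) hω
  rw [frameAvg_eq_div]
  exact div_le_div_of_nonneg_right (X.sum_delta_le_queue lam K n ω) (Nat.cast_nonneg K)

end IsAlgorithm

end System

end TaskScheduling

end

theorem theorem1 {N : ℕ} {M : Type v} [Finite M] (S : TaskScheduling.System N M)
    (lam : Fin N → ℝ) (hfeas : S.Feasible lam) (V : ℝ) (hV : 0 ≤ V) :
    -- constants `B` and `β` exist, uniformly over all policies
    (∃ B β : ℝ, ∀ (Ω : Type u) [MeasurableSpace Ω] (P : Measure Ω) [IsProbabilityMeasure P]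
      (X : TaskScheduling.Trajectory N M Ω), S.IsPolicy P X →
        TaskScheduling.System.IsDriftBound P lam X B ∧ S.IsPenaltyBound P lam X β) ∧
    -- performance of the task scheduling algorithm
    ∀ (Ω : Type u) [MeasurableSpace Ω] (P : Measure Ω) [IsProbabilityMeasure P]
      (X : TaskScheduling.Trajectory N M Ω), S.IsAlgorithm lam V P X →
      -- all expectations below are those of integrable random variables
      (∀ k, Integrable (X.e k) P ∧ Integrable (X.D k) P ∧ Integrable (X.I k) P ∧
        (∀ n, Integrable (X.ind n k) P) ∧ (∀ n, Integrable (X.queue lam k n) P) ∧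
        Integrable (X.queueNorm lam k) P) ∧
      -- (a) average power
      (∀ B : ℝ, TaskScheduling.System.IsDriftBound P lam X B → 0 < V → ∀ K : ℕ, 1 ≤ K →
        TaskScheduling.expAvg P X.e K /
            (TaskScheduling.expAvg P X.D K + TaskScheduling.expAvg P X.I K)
          ≤ S.powerOpt lam +
            B / (V * (TaskScheduling.expAvg P X.D K + TaskScheduling.expAvg P X.I K))) ∧
      -- (b) queue bound
      (∀ B β : ℝ, TaskScheduling.System.IsDriftBound P lam X B → S.IsPenaltyBound P lam X β →
        ∀ K : ℕ, 1 ≤ K →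
          (∫ ω, X.queueNorm lam K ω ∂P) / K ≤ Real.sqrt (2 * (B + V * β) / K)) ∧
      -- (b) stability of the queues and the rate constraints, in expectation and almost surely
      (∀ n : Fin N,
        Tendsto (fun K : ℕ => (∫ ω, X.queue lam K n ω ∂P) / K) atTop (𝓝 0) ∧
        limsup (fun K : ℕ => ((lam n * (TaskScheduling.expAvg P X.D K +
          TaskScheduling.expAvg P X.I K) - TaskScheduling.expAvg P (X.ind n) K : ℝ) : EReal))
            atTop ≤ 0 ∧
        (∀ᵐ ω ∂P, Tendsto (fun K : ℕ => X.queue lam K n ω / K) atTop (𝓝 0)) ∧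
        (∀ᵐ ω ∂P, limsup (fun K : ℕ => ((TaskScheduling.frameAvg
          (fun k ω' => lam n * (X.D k ω' + X.I k ω') - X.ind n k ω') K ω : ℝ) : EReal))
            atTop ≤ 0)) := by
  -- The witnesses are read off from `isDriftBound` and `isPenaltyBound`; they involve neither `Ω`
  -- nor `X`, which gives uniformity over policies.
  refine ⟨⟨_, _, fun Ω _ P _ X h => ⟨h.isDriftBound lam, h.isPenaltyBound lam⟩⟩,
    fun Ω _ P _ X h => ⟨fun k => ⟨(h.memLp_e k).integrable one_le_two,
      (h.memLp_D k).integrable one_le_two, (h.memLp_I k).integrable one_le_two,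
      fun n => (h.memLp_ind n k).integrable one_le_two,
      fun n => (h.memLp_queue lam k n).integrable one_le_two,
      (h.memLp_queueNorm lam k).integrable one_le_two⟩,
    fun B hB hV' K hK => h.averagePower_le hfeas hV' hB hK,
    fun B β hB hβ K hK => h.integral_queueNorm_div_le hfeas hV hB hβ hK,
    fun n => ⟨h.tendsto_integral_queue_div hfeas hV n, h.limsup_expAvg_le hfeas hV n,
      h.ae_tendsto_queue_div hfeas hV n, h.ae_limsup_frameAvg_le hfeas hV n⟩⟩⟩
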